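/- Let $\mathbb S$ be the unit sphere of $\mathbb R^3$ with surface measure $d\xi$ (total mass $4\pi$), and let $\mathbb H=L^2(\mathbb S;\mathbb C)$ with $\langle f,g\rangle=\int_{\mathbb S} f\,\overline{g}\,d\xi$. For $\ell\in\mathbb N$ let $\mathbb H_\ell$ be the span of the spherical harmonics $Y_{\ell m}$, $-\ell\le m\le\ell$, let $\Pi_\ell$ be the orthogonal projection of $\mathbb H$ onto $\mathbb H_\ell$, and let $L_\ell=\frac{2\ell+1}{4\pi}P_\ell$, where $P_\ell$ is the Legendre polynomial with $P_\ell(1)=1$. Let $\mathcal J$ be a countable set. For each $j\in\mathcal J$ let $h^{(j)}=(h^{(j)}_\ell)_{\ell\in\mathbb N}$ be a non-negative sequence with finite support; put $b^{(j)}_\ell=\sqrt{h^{(j)}_\ell}$, $d^{(j)}=\max\{\ell: h^{(j)}_\ell\ne0\}$ (and $d^{(j)}=0$ if $h^{(j)}=0$) and $\Psi^{(j)}=\sum_{\ell}h^{(j)}_\ell\Pi_\ell$. For each $j\in\mathcal J$ let also $K^{(j)}$ be a finite set, and let $\xi^{(j)}_k\in\mathbb S$ and $\lambda^{(j)}_k\in\mathbb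 R$ for $k\in K^{(j)}$. The family $\{(\xi^{(j)}_k,\lambda^{(j)}_k)\}_{k\in K^{(j)}}$ provides an exact and positive-weight quadrature formula at degree $D$ if $\int_{\mathbb S}X(\xi)\,d\xi=\sum_{k\in K^{(j)}}\lambda^{(j)}_kX(\xi^{(j)}_k)$ for all $X\in\bigoplus_{\ell=0}^{D}\mathbb H_\ell$, and $\lambda^{(j)}_k>0$ for all $k\in K^{(j)}$. Define the needlets and, for $X\in\mathbb H$, the needlet coefficients by $$\psi^{(j)}_k(\xi)=\sqrt{\lambda^{(j)}_k}\sum_{\ell=0}^{d^{(j)}}b^{(j)}_\ell L_\ell(\xi\cdot\xi^{(j)}_k),\qquad \beta^{(j)}_k=\langle X,\psi^{(j)}_k\rangle .$$ (1) Let $j\in\mathcal J$. If $\{(\xi^{(j)}_k,\lambda^{(j)}_k)\}_{k\in K^{(j)}}$ provides an exact and positive-weight quadrature formula at degree $2d^{(j)}$, then for every $X\in\mathbb H$ $$\Psi^{(j)}X=\sum_{k\in K^{(j)}}\beta^{(j)}_k\psi^{(j)}_k .$$ (2) If this quadrature assumption holds for every $j\in\mathcal J$ and $\sum_{j\in\mathcal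 J}h^{(j)}_\ell=1$ for every $\ell\in\mathbb N$, then the family $\{\psi^{(j)}_k\}_{j\in\mathcal J,\,k\in K^{(j)}}$ is a tight frame of $\mathbb H$ (that is, for some $C>0$, $\sum_{j,k}|\langle X,\psi^{(j)}_k\rangle|^2=C\|X\|^2$ for all $X\in\mathbb H$), and for every $X\in\mathbb H$ $$X=\sum_{j\in\mathcal J}\sum_{k\in K^{(j)}}\beta^{(j)}_k\psi^{(j)}_k\quad\text{and}\quad \|X\|^2=\sum_{j\in\mathcal J}\sum_{k\in K^{(j)}}|\beta^{(j)}_k|^2,$$ where the first series converges unconditionally in $\mathbb H$. -/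

import Mathlib

namespace SphereNeedlet

open MeasureTheory

noncomputable section

/-- The unit sphere of `ℝ³`. -/
abbrev S2 : Type := Metric.sphere (0 : EuclideanSpace ℝ (Fin 3)) 1

/-- The surface measure of the unit sphere (`sin θ dθ dφ` in spherical coordinates, of total
mass `4π`). -/
abbrev surfaceMeasure : Measure S2 :=
  (volume : Measure (EuclideanSpace ℝ (Fin 3))).toSphere

/-- The Hilbert space of complex-valued square integrable functions on the sphere. Mathlib's
`inner ℂ g f` is `∫ f * conj g`, that is, the inner product `⟨f, g⟩` which is linear in `f`. -/
abbrev SphereL2 : Type := Lp ℂ 2 surfaceMeasure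

/-- The class in `L²` of a continuous function. -/
abbrev toL2 : C(S2, ℂ) →L[ℂ] SphereL2 := ContinuousMap.toLp 2 surfaceMeasure ℂ

/-- The Legendre polynomial `P_ℓ` with `P_ℓ(1) = 1`, by Rodrigues' formula. -/
def legendreP (ℓ : ℕ) : Polynomial ℝ :=
  Polynomial.C ((2 ^ ℓ * (Nat.factorial ℓ : ℝ))⁻¹) *
    Polynomial.derivative^[ℓ] ((Polynomial.X ^ 2 - 1) ^ ℓ)

/-- The renormalized Legendre polynomial `L_ℓ(z) = (2ℓ+1)/(4π) P_ℓ(z)`. -/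
def legendreL (ℓ : ℕ) (z : ℝ) : ℝ :=
  (2 * (ℓ : ℝ) + 1) / (4 * Real.pi) * (legendreP ℓ).eval z

/-- The associated Legendre function of order `m ≥ 0`,
`P_{ℓm}(x) = (-1)^m (1-x²)^{m/2} (d/dx)^m P_ℓ(x)`. -/
def assocLegendreNat (ℓ m : ℕ) (x : ℝ) : ℝ :=
  (-1) ^ m * Real.sqrt (1 - x ^ 2) ^ m * (Polynomial.derivative^[m] (legendreP ℓ)).eval x

/-- The associated Legendre function of any order, with the usual convention
`P_{ℓ,-m} = (-1)^m (ℓ-m)!/(ℓ+m)! P_{ℓm}` for negative orders (`m` is used with `|m| ≤ ℓ`). -/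
def assocLegendre (ℓ : ℕ) (m : ℤ) (x : ℝ) : ℝ :=
  if 0 ≤ m then assocLegendreNat ℓ m.natAbs x
  else (-1) ^ m.natAbs *
    ((Nat.factorial (ℓ - m.natAbs) : ℝ) / (Nat.factorial (ℓ + m.natAbs) : ℝ)) *
      assocLegendreNat ℓ m.natAbs x

/-- `cos θ`, for `θ` the colatitude. -/
def cosColat (ξ : S2) : ℝ := ξ.1 2

/-- `x + i y = sin θ e^{iφ}`. -/
def equatorial (ξ : S2) : ℂ := ⟨ξ.1 0, ξ.1 1⟩

/-- The longitude `φ`, modulo `2π` (and `0` at the poles). -/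
def longitude (ξ : S2) : ℝ := (equatorial ξ).arg

/-- The constant `√((2ℓ+1)/(4π) (ℓ-m)!/(ℓ+m)!)`. -/
def harmonicConst (ℓ : ℕ) (m : ℤ) : ℝ :=
  Real.sqrt ((2 * (ℓ : ℝ) + 1) / (4 * Real.pi) *
    ((Nat.factorial ((ℓ : ℤ) - m).toNat : ℝ) / (Nat.factorial ((ℓ : ℤ) + m).toNat : ℝ)))

/-- The complex spherical harmonic `Y_{ℓm}` (for `-ℓ ≤ m ≤ ℓ`) as a function on the sphere. -/
def sphericalHarmonicFun (ℓ : ℕ) (m : ℤ) (ξ : S2) : ℂ :=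
  (harmonicConst ℓ m : ℂ) * (assocLegendre ℓ m (cosColat ξ) : ℂ) *
    Complex.exp (Complex.I * m * longitude ξ)

theorem norm_equatorial (ξ : S2) : ‖equatorial ξ‖ = Real.sqrt (1 - cosColat ξ ^ 2) := by
  have h : ‖ξ.1‖ = 1 := by simp
  rw [EuclideanSpace.norm_eq, Real.sqrt_eq_one] at h
  simp only [Fin.sum_univ_three, Real.norm_eq_abs, sq_abs] at h
  rw [Complex.norm_def, Complex.normSq_apply]
  congr 1
  simp only [equatorial, cosColat]
  linarith

/-- `sin^{|m|} θ e^{imφ}` is the `|m|`-th power of `x + i y` or of its conjugate. -/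
theorem sqrt_pow_mul_exp (m : ℤ) (ξ : S2) :
    (Real.sqrt (1 - cosColat ξ ^ 2) : ℂ) ^ m.natAbs *
        Complex.exp (Complex.I * m * longitude ξ) =
      (if 0 ≤ m then equatorial ξ else (starRingEnd ℂ) (equatorial ξ)) ^ m.natAbs := by
  have hw := Complex.norm_mul_exp_arg_mul_I (equatorial ξ)
  rw [norm_equatorial] at hw
  have hc : (Real.sqrt (1 - cosColat ξ ^ 2) : ℂ) *
      Complex.exp (-((equatorial ξ).arg * Complex.I)) = (starRingEnd ℂ) (equatorial ξ) := by
    conv_rhs => rw [← hw]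
    rw [map_mul, Complex.conj_ofReal, ← Complex.exp_conj, map_mul, Complex.conj_ofReal,
      Complex.conj_I, mul_neg]
  obtain ⟨n, rfl | rfl⟩ := m.eq_nat_or_neg
  · rw [if_pos (by positivity)]
    conv_rhs => rw [← hw]
    rw [mul_pow, ← Complex.exp_nat_mul]
    simp only [Int.natAbs_natCast, Int.cast_natCast, longitude]
    congr 2
    ring
  · rcases Nat.eq_zero_or_pos n with rfl | hn
    · simp
    · rw [if_neg (by omega), ← hc, mul_pow, ← Complex.exp_nat_mul]
      simp only [Int.natAbs_neg, Int.natAbs_natCast, Int.cast_neg, Int.cast_natCast, longitude]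
      congr 2
      ring

theorem continuous_sphericalHarmonicFun (ℓ : ℕ) (m : ℤ) :
    Continuous (sphericalHarmonicFun ℓ m) := by
  have hz : Continuous cosColat := by unfold cosColat; fun_prop
  have hw : Continuous equatorial := by
    have : equatorial = fun ξ : S2 => ((ξ.1 0 : ℝ) : ℂ) + ((ξ.1 1 : ℝ) : ℂ) * Complex.I := by
      funext ξ
      exact Complex.mk_eq_add_mul_I _ _
    rw [this]
    fun_prop
  have hp : Continuous fun ξ : S2 =>
      (Polynomial.derivative^[m.natAbs] (legendreP ℓ)).eval (cosColat ξ) :=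
    (Polynomial.continuous _).comp hz
  have key : sphericalHarmonicFun ℓ m = fun ξ : S2 =>
      (harmonicConst ℓ m : ℂ) *
        (((if 0 ≤ m then (1 : ℝ) else (-1) ^ m.natAbs * ((Nat.factorial (ℓ - m.natAbs) : ℝ) /
          (Nat.factorial (ℓ + m.natAbs) : ℝ))) * (-1) ^ m.natAbs : ℝ) : ℂ) *
        (((Polynomial.derivative^[m.natAbs] (legendreP ℓ)).eval (cosColat ξ) : ℝ) : ℂ) *
        (if 0 ≤ m then equatorial ξ else (starRingEnd ℂ) (equatorial ξ)) ^ m.natAbs := by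
    funext ξ
    rw [← sqrt_pow_mul_exp, sphericalHarmonicFun, assocLegendre, assocLegendreNat]
    split_ifs <;> push_cast <;> ring
  rw [key]
  split_ifs
  · fun_prop
  · have := Complex.continuous_conj.comp hw
    simp only [Function.comp_def] at this
    fun_prop

/-- The complex spherical harmonic `Y_{ℓm}` as a continuous function. -/
def sphericalHarmonic (ℓ : ℕ) (m : ℤ) : C(S2, ℂ) :=
  ⟨sphericalHarmonicFun ℓ m, continuous_sphericalHarmonicFun ℓ m⟩

/-- The space of continuous functions spanned by `Y_{ℓm}`, `m = -ℓ, …, ℓ`. -/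
def harmonicFun (ℓ : ℕ) : Submodule ℂ C(S2, ℂ) :=
  Submodule.span ℂ (sphericalHarmonic ℓ '' Set.Icc (-(ℓ : ℤ)) (ℓ : ℤ))

/-- The same space `ℍ_ℓ` inside `L²`. -/
def harmonicSpace (ℓ : ℕ) : Submodule ℂ SphereL2 :=
  (harmonicFun ℓ).map (toL2 : C(S2, ℂ) →ₗ[ℂ] SphereL2)

instance (ℓ : ℕ) : FiniteDimensional ℂ (harmonicFun ℓ) :=
  FiniteDimensional.span_of_finite ℂ ((Set.finite_Icc _ _).image _)

instance (ℓ : ℕ) : FiniteDimensional ℂ (harmonicSpace ℓ) := by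
  unfold harmonicSpace
  infer_instance

/-- `Π_ℓ`, the orthogonal projection of `L²` onto `ℍ_ℓ`. -/
def harmonicProj (ℓ : ℕ) : SphereL2 →L[ℂ] SphereL2 := (harmonicSpace ℓ).starProjection

/-- The harmonic smoothing operator `Ψ = ∑_ℓ h_ℓ Π_ℓ` of a window `h`, the series being taken in
the strong sense (it is a finite sum if `h` has finite support). -/
def smoothing (h : ℕ → ℝ) (X : SphereL2) : SphereL2 :=
  ∑' ℓ, (h ℓ : ℂ) • harmonicProj ℓ X

/-- `d = max {ℓ : h_ℓ ≠ 0}` for a window of finite support (and `0` for the zero window). -/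
def bandLimit (h : ℕ → ℝ) : ℕ := sSup {ℓ | h ℓ ≠ 0}

/-- `b_ℓ = √h_ℓ`. -/
def sqrtWindow (h : ℕ → ℝ) (ℓ : ℕ) : ℝ := Real.sqrt (h ℓ)

/-- The points `ξ_k` and weights `w_k` give an exact Gauss quadrature formula at degree `L`: it
holds for all functions in `⨁_{ℓ ≤ L} ℍ_ℓ`. -/
def IsExactQuadrature {K : Type*} [Fintype K] (ξ : K → S2) (w : K → ℝ) (L : ℕ) : Prop :=
  ∀ X ∈ ⨆ ℓ ∈ Set.Iic L, harmonicFun ℓ,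
    ∫ η, X η ∂surfaceMeasure = ∑ k, (w k : ℂ) * X (ξ k)

/-- An exact quadrature formula with positive weights. -/
def IsPositiveExactQuadrature {K : Type*} [Fintype K] (ξ : K → S2) (w : K → ℝ) (L : ℕ) : Prop :=
  IsExactQuadrature ξ w L ∧ ∀ k, 0 < w k

theorem continuous_legendreL (ℓ : ℕ) : Continuous (legendreL ℓ) :=
  continuous_const.mul (Polynomial.continuous _)

/-- The needlet `ψ(ξ) = √w ∑_{ℓ ≤ d} b_ℓ L_ℓ(ξ · η)` with center `η` and weight `w`, for the
window `h`, `b = √h`, as a continuous function. -/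
def needletFun (h : ℕ → ℝ) (η : S2) (w : ℝ) : C(S2, ℂ) where
  toFun ξ := ((Real.sqrt w * ∑ ℓ ∈ Finset.range (bandLimit h + 1),
    sqrtWindow h ℓ * legendreL ℓ (inner ℝ (ξ : EuclideanSpace ℝ (Fin 3)) η) : ℝ) : ℂ)
  continuous_toFun := by
    refine Complex.continuous_ofReal.comp (continuous_const.mul ?_)
    refine continuous_finsetSum _ fun ℓ _ => continuous_const.mul ?_
    exact (continuous_legendreL ℓ).comp (by fun_prop)

/-- The needlet as an element of `L²`. -/
def needlet (h : ℕ → ℝ) (η : S2) (w : ℝ) : SphereL2 := toL2 (needletFun h η w)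

/-- The needlet coefficient `β = ⟨X, ψ⟩`. -/
def needletCoeff (h : ℕ → ℝ) (η : S2) (w : ℝ) (X : SphereL2) : ℂ := inner ℂ (needlet h η w) X

/-- `f` is a frame with bounds `C₁`, `C₂`: `C₁ ‖g‖² ≤ ∑ |⟨g, f_n⟩|² ≤ C₂ ‖g‖²` for all `g`. -/
def IsFrame {ι E : Type*} [NormedAddCommGroup E] [InnerProductSpace ℂ E] (f : ι → E)
    (C₁ C₂ : ℝ) : Prop :=
  0 < C₁ ∧ ∀ g : E, Summable (fun n => ‖inner ℂ (f n) g‖ ^ 2) ∧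
    C₁ * ‖g‖ ^ 2 ≤ ∑' n, ‖inner ℂ (f n) g‖ ^ 2 ∧ ∑' n, ‖inner ℂ (f n) g‖ ^ 2 ≤ C₂ * ‖g‖ ^ 2

/-- A tight frame is a frame with equal bounds. -/
def IsTightFrame {ι E : Type*} [NormedAddCommGroup E] [InnerProductSpace ℂ E] (f : ι → E) : Prop :=
  ∃ C : ℝ, IsFrame f C C

end

end SphereNeedlet

/-!
The operator `Ψ = ∑ h_ℓ Π_ℓ` is the square of `B = ∑ b_ℓ Π_ℓ`. Since `L_ℓ(ξ · η)` is the
reproducing kernel of `ℍ_ℓ` (`inner_legendreKernel`), the needlet coefficients of `X` are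
`√λ_k (B X)(ξ_k)`, and `∑_k β_k ψ_k(ζ)` is the quadrature of the product of `B X` with the kernel of
`B` at `ζ`. That product is a polynomial of degree at most `2 d`, so the quadrature is its integral,
which is `(B B X)(ζ) = (Ψ X)(ζ)` (`smoothing_eq_sum_needlet`).

Pairing this identity with `X` gives `∑_k |β_k|² = ∑_ℓ h_ℓ ‖Π_ℓ X‖²`. Summing over the windows and
exchanging the two sums of non-negative terms, the partition of unity and Parseval's identity
`∑_ℓ ‖Π_ℓ X‖² = ‖X‖²` give `∑_{j,k} |β_k|² = ‖X‖²`. Any family with this property reconstructs every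
vector, with unconditional convergence (`hasSum_inner_smul_of_parseval`).

The harmonic analysis is obtained from the explicit functions `Y_{ℓm}`. Together with Archimedes'
theorem on the height function (`integral_eval_cosColat`) and the invariance under axial rotations,
integration by parts in Rodrigues' formula shows that the spaces `ℍ_ℓ` are mutually orthogonal.
The identity `x² + y² = 1 - z²` and a triangular change of basis show that `ℍ_0, …, ℍ_n` together
span the restrictions of the polynomials of degree at most `n` (`iSup_harmonicFun`). Hence products
of harmonics are controlled, the `ℍ_ℓ` are total by the Stone–Weierstrass theorem, and `ℍ_ℓ`, being
the orthogonal complement of the polynomials of degree less than `ℓ` in those of degree at most `ℓ`,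
is invariant under all isometries (`pullback_mem_harmonicFun`). The reproducing property therefore
has to be verified at the north pole only, where it amounts to `P_ℓ(1) = 1` and
`∫ P_ℓ² = 2 / (2 ℓ + 1)`.
-/

namespace SphereNeedlet

open MeasureTheory Polynomial

/-! ### Legendre polynomials on the interval -/

/-- The functional `p ↦ ∫_{-1}^{1} p(t) dt` on real polynomials. -/
noncomputable def intervalFunctional : ℝ[X] →ₗ[ℝ] ℝ where
  toFun p := ∫ t in (-1 : ℝ)..1, p.eval t
  map_add' p q := by
    simp only [eval_add]
    exact intervalIntegral.integral_add (p.continuous.intervalIntegrable _ _)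
      (q.continuous.intervalIntegrable _ _)
  map_smul' c p := by simp

theorem intervalFunctional_derivative (p : ℝ[X]) :
    intervalFunctional (derivative p) = p.eval 1 - p.eval (-1) :=
  intervalIntegral.integral_eq_sub_of_hasDerivAt (fun x _ => p.hasDerivAt x)
    ((derivative p).continuous.intervalIntegrable _ _)

theorem intervalFunctional_X_pow (n : ℕ) :
    intervalFunctional (X ^ n) = (1 - (-1) ^ (n + 1)) / (n + 1) := by
  simp [intervalFunctional]

/-- Repeated integration by parts: there are no boundary terms if `p` vanishes to order `n` at
both endpoints. -/
theorem intervalFunctional_iterate_derivative_mul (n : ℕ) (p q : ℝ[X])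
    (h : (X ^ 2 - 1) ^ n ∣ p) :
    intervalFunctional (derivative^[n] p * q) =
      (-1) ^ n * intervalFunctional (p * derivative^[n] q) := by
  induction n generalizing p with
  | zero => simp
  | succ n ih =>
    obtain ⟨r, rfl⟩ := h
    set p := (X ^ 2 - 1) ^ (n + 1) * r with hp
    have hdvd : (X ^ 2 - 1) ^ n ∣ derivative p := by
      rw [hp, derivative_mul, derivative_pow_succ]
      exact dvd_add ((dvd_mul_of_dvd_left (dvd_mul_of_dvd_left (dvd_mul_left _ _) _) _))
        (dvd_mul_of_dvd_left (pow_dvd_pow _ n.le_succ) _)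
    have hb := intervalFunctional_derivative (p * derivative^[n] q)
    rw [derivative_mul, map_add, ← Function.iterate_succ_apply' derivative] at hb
    have h0 : (p * derivative^[n] q).eval 1 - (p * derivative^[n] q).eval (-1) = 0 := by
      simp [hp]
    rw [Function.iterate_succ_apply, ih _ hdvd]
    rw [h0] at hb
    rw [pow_succ]
    linear_combination (-1) ^ n * hb

theorem natDegree_X_sq_sub_one_pow (ℓ : ℕ) : ((X ^ 2 - 1 : ℝ[X]) ^ ℓ).natDegree = 2 * ℓ := by
  rw [natDegree_pow, ← C_1, natDegree_X_pow_sub_C, mul_comm]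

theorem legendreP_coeff_self_ne_zero (ℓ : ℕ) : (legendreP ℓ).coeff ℓ ≠ 0 := by
  have hm : ((X ^ 2 - 1 : ℝ[X]) ^ ℓ).Monic := by
    rw [← C_1]
    exact (monic_X_pow_sub_C 1 two_ne_zero).pow ℓ
  have hc : ((X ^ 2 - 1 : ℝ[X]) ^ ℓ).coeff (ℓ + ℓ) = 1 := by
    rw [← two_mul, ← natDegree_X_sq_sub_one_pow]
    exact hm
  rw [legendreP, coeff_C_mul, coeff_iterate_derivative, hc, nsmul_one]
  have : (ℓ + ℓ).descFactorial ℓ ≠ 0 := (Nat.descFactorial_pos.2 (by omega)).ne'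
  positivity

theorem natDegree_legendreP (ℓ : ℕ) : (legendreP ℓ).natDegree = ℓ := by
  refine natDegree_eq_of_le_of_coeff_ne_zero ?_ (legendreP_coeff_self_ne_zero ℓ)
  refine (natDegree_C_mul_le _ _).trans ((natDegree_iterate_derivative _ _).trans ?_)
  rw [natDegree_X_sq_sub_one_pow]
  omega

theorem natDegree_iterate_derivative_legendreP (ℓ m : ℕ) :
    (derivative^[m] (legendreP ℓ)).natDegree = ℓ - m := by
  induction m with
  | zero => simp [natDegree_legendreP]
  | succ m ih => rw [Function.iterate_succ_apply', natDegree_derivative, ih]; omega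

theorem iterate_derivative_legendreP_ne_zero {ℓ m : ℕ} (h : m ≤ ℓ) :
    derivative^[m] (legendreP ℓ) ≠ 0 := by
  intro h0
  have := congrArg (fun p => coeff p (ℓ - m)) h0
  simp only [coeff_iterate_derivative, coeff_zero, Nat.sub_add_cancel h, nsmul_eq_mul,
    mul_eq_zero, Nat.cast_eq_zero, Nat.descFactorial_eq_zero_iff_lt] at this
  exact this.elim (by omega) (legendreP_coeff_self_ne_zero ℓ)

theorem intervalFunctional_legendreP_mul {ℓ : ℕ} {q : ℝ[X]} (hq : q.natDegree < ℓ) :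
    intervalFunctional (legendreP ℓ * q) = 0 := by
  rw [legendreP, mul_assoc, ← smul_eq_C_mul, map_smul,
    intervalFunctional_iterate_derivative_mul _ _ _ dvd_rfl, iterate_derivative_eq_zero hq]
  simp

/-- The derivatives of order `m` of the Legendre polynomials are orthogonal for the weight
`(1 - t²) ^ m`. -/
theorem intervalFunctional_iterate_derivative_legendreP {ℓ ℓ' m : ℕ} (hm : m ≤ ℓ) (h : ℓ < ℓ') :
    intervalFunctional ((1 - X ^ 2) ^ m *
      (derivative^[m] (legendreP ℓ) * derivative^[m] (legendreP ℓ'))) = 0 := by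
  -- Move all `m` derivatives away from `legendreP ℓ'`: the degree of the other factor is `ℓ`.
  have key := intervalFunctional_iterate_derivative_mul m
    ((X ^ 2 - 1) ^ m * derivative^[m] (legendreP ℓ)) (legendreP ℓ') (dvd_mul_right _ _)
  rw [mul_comm, intervalFunctional_legendreP_mul] at key
  · have hs : (1 - X ^ 2 : ℝ[X]) ^ m = (-1 : ℝ) ^ m • (X ^ 2 - 1) ^ m := by
      rw [smul_eq_C_mul, C_pow, ← mul_pow]; congr 1; simp
    rw [hs, smul_mul_assoc, map_smul, ← mul_assoc, smul_eq_mul, ← key]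
  · refine (natDegree_iterate_derivative _ _).trans_lt ?_
    have := natDegree_mul_le (p := (X ^ 2 - 1 : ℝ[X]) ^ m) (q := derivative^[m] (legendreP ℓ))
    rw [natDegree_X_sq_sub_one_pow, natDegree_iterate_derivative_legendreP] at this
    omega

theorem legendreP_eval_one (ℓ : ℕ) : (legendreP ℓ).eval 1 = 1 := by
  have h := aeval_iterate_derivative_self ((X ^ 2 - 1 : ℝ[X]) ^ ℓ) ℓ (1 : ℝ)
    (p' := (X + 1) ^ ℓ) (by simp [← mul_pow]; ring)
  rw [coe_aeval_eq_eval] at h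
  rw [legendreP, eval_mul, h]
  simp only [eval_C, eval_pow, eval_add, eval_X, eval_one, nsmul_eq_mul, one_add_one_eq_two]
  rw [mul_comm (2 ^ ℓ : ℝ)]
  exact inv_mul_cancel₀ (by positivity)

theorem legendreP_eval_neg_one (ℓ : ℕ) : (legendreP ℓ).eval (-1) = (-1) ^ ℓ := by
  have h := aeval_iterate_derivative_self ((X ^ 2 - 1 : ℝ[X]) ^ ℓ) ℓ (-1 : ℝ)
    (p' := (X - 1) ^ ℓ) (by simp [← mul_pow]; ring)
  rw [coe_aeval_eq_eval] at h
  rw [legendreP, eval_mul, h]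
  simp only [eval_C, eval_pow, eval_sub, eval_X, eval_one, nsmul_eq_mul]
  rw [show (-1 - 1 : ℝ) = -1 * 2 by norm_num, mul_pow]
  field_simp

theorem intervalFunctional_legendreP_sq (ℓ : ℕ) :
    intervalFunctional (legendreP ℓ * legendreP ℓ) = 2 / (2 * ℓ + 1) := by
  set P := legendreP ℓ with hP
  -- Euler's operator multiplies the leading term of `P` by `ℓ`.
  have hlow : intervalFunctional (P * (X * derivative P - C (ℓ : ℝ) * P)) = 0 := by
    rcases Nat.eq_zero_or_pos ℓ with rfl | hℓ
    · have : derivative P = 0 := by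
        rw [derivative_of_natDegree_zero]; exact natDegree_legendreP 0
      simp [this]
    · refine intervalFunctional_legendreP_mul ?_
      by_cases h0 : X * derivative P - C (ℓ : ℝ) * P = 0
      · rwa [h0, natDegree_zero]
      rw [natDegree_lt_iff_degree_lt h0]
      rw [degree_lt_iff_coeff_zero]
      intro k hk
      obtain ⟨k, rfl⟩ : ∃ i, k = i + 1 := ⟨k - 1, by omega⟩
      rw [coeff_sub, coeff_X_mul, coeff_derivative, coeff_C_mul]
      rcases hk.eq_or_lt with h | h
      · rw [h]; push_cast; ring
      · rw [coeff_eq_zero_of_natDegree_lt (by rw [hP, natDegree_legendreP]; exact h)]; simp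
  have hb := intervalFunctional_derivative (X * (P * P))
  have h1 : P.eval 1 = 1 := legendreP_eval_one ℓ
  have h2 : P.eval (-1) * P.eval (-1) = 1 := by
    rw [hP, legendreP_eval_neg_one, ← mul_pow]; simp
  have he : derivative (X * (P * P)) =
      (2 * ℓ + 1 : ℝ) • (P * P) + (2 : ℝ) • (P * (X * derivative P - C (ℓ : ℝ) * P)) := by
    simp only [derivative_mul, derivative_X, smul_eq_C_mul, map_add, map_mul, map_one, map_ofNat]
    ring
  rw [he, map_add, map_smul, map_smul, hlow] at hb
  simp only [eval_mul, eval_X, h1, h2] at hb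
  rw [eq_div_iff (by positivity)]
  simp only [smul_eq_mul] at hb
  linarith

/-! ### The surface measure: isometries and zonal integrals -/

/-- The self-map of the sphere induced by a linear isometry of `ℝ³`. -/
noncomputable def sphereMap (R : EuclideanSpace ℝ (Fin 3) ≃ₗᵢ[ℝ] EuclideanSpace ℝ (Fin 3)) :
    C(S2, S2) where
  toFun ξ := ⟨R ξ, by simp⟩
  continuous_toFun := by fun_prop

@[simp]
theorem coe_sphereMap (R : EuclideanSpace ℝ (Fin 3) ≃ₗᵢ[ℝ] EuclideanSpace ℝ (Fin 3)) (ξ : S2) :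
    (sphereMap R ξ : EuclideanSpace ℝ (Fin 3)) = R ξ := rfl

@[simp]
theorem sphereMap_symm_sphereMap
    (R : EuclideanSpace ℝ (Fin 3) ≃ₗᵢ[ℝ] EuclideanSpace ℝ (Fin 3)) (ξ : S2) :
    sphereMap R.symm (sphereMap R ξ) = ξ := Subtype.ext (by simp)

@[simp]
theorem sphereMap_sphereMap_symm
    (R : EuclideanSpace ℝ (Fin 3) ≃ₗᵢ[ℝ] EuclideanSpace ℝ (Fin 3)) (ξ : S2) :
    sphereMap R (sphereMap R.symm ξ) = ξ := Subtype.ext (by simp)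

open scoped Pointwise in
theorem measurePreserving_sphereMap
    (R : EuclideanSpace ℝ (Fin 3) ≃ₗᵢ[ℝ] EuclideanSpace ℝ (Fin 3)) :
    MeasurePreserving (sphereMap R) surfaceMeasure surfaceMeasure := by
  have hm : Measurable (sphereMap R) := (sphereMap R).continuous.measurable
  refine ⟨hm, Measure.ext fun s hs => ?_⟩
  -- The cone over the preimage of `s` is the preimage of the cone over `s`.
  have hcone : Set.Ioo (0 : ℝ) 1 • (((↑) : S2 → EuclideanSpace ℝ (Fin 3)) '' (sphereMap R ⁻¹' s)) =
      R ⁻¹' (Set.Ioo (0 : ℝ) 1 • (((↑) : S2 → EuclideanSpace ℝ (Fin 3)) '' s)) := by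
    ext x
    simp only [Set.mem_smul, Set.mem_preimage, Set.exists_mem_image]
    constructor
    · rintro ⟨r, hr, ξ, hξ, rfl⟩
      exact ⟨r, hr, sphereMap R ξ, hξ, by simp⟩
    · rintro ⟨r, hr, η, hη, h⟩
      refine ⟨r, hr, sphereMap R.symm η, by simpa using hη, ?_⟩
      apply R.injective
      rw [map_smul, ← h]
      simp
  rw [Measure.map_apply hm hs, Measure.toSphere_apply' _ (hm hs), Measure.toSphere_apply' _ hs,
    hcone, R.measurePreserving.measure_preimage_emb R.toHomeomorph.measurableEmbedding]

theorem integral_comp_sphereMap {F : Type*} [NormedAddCommGroup F] [NormedSpace ℝ F]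
    (R : EuclideanSpace ℝ (Fin 3) ≃ₗᵢ[ℝ] EuclideanSpace ℝ (Fin 3)) {f : S2 → F}
    (hf : Continuous f) :
    ∫ ξ, f (sphereMap R ξ) ∂surfaceMeasure = ∫ ξ, f ξ ∂surfaceMeasure := by
  have h := measurePreserving_sphereMap R
  conv_rhs => rw [← h.map_eq]
  rw [integral_map h.measurable.aemeasurable hf.aestronglyMeasurable]

theorem integrable_of_continuous {F : Type*} [NormedAddCommGroup F] {f : S2 → F}
    (hf : Continuous f) : Integrable f surfaceMeasure :=
  hf.integrable_of_hasCompactSupport (HasCompactSupport.of_compactSpace f)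

/-- Integration in polar coordinates of a function which separates into an angular and a radial
part. -/
theorem integral_mul_radial (F : EuclideanSpace ℝ (Fin 3) → ℝ) (f : S2 → ℝ) (g : ℝ → ℝ)
    (h : ∀ (ξ : S2) (r : ℝ), 0 < r → F (r • (ξ : EuclideanSpace ℝ (Fin 3))) = f ξ * g r) :
    ∫ x, F x = (∫ ξ, f ξ ∂surfaceMeasure) * ∫ r in Set.Ioi (0 : ℝ), r ^ 2 * g r := by
  have hdim : Module.finrank ℝ (EuclideanSpace ℝ (Fin 3)) - 1 = 2 := by simp
  calc
    ∫ x, F x = ∫ x : ({(0)}ᶜ : Set (EuclideanSpace ℝ (Fin 3))), F x.1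
        ∂((volume : Measure (EuclideanSpace ℝ (Fin 3))).comap (↑)) := by
      rw [integral_subtype_comap (measurableSet_singleton _).compl F,
        restrict_compl_singleton]
    _ = ∫ p : S2 × Set.Ioi (0 : ℝ), f p.1 * g p.2
          ∂(surfaceMeasure.prod (.volumeIoiPow 2)) := by
      rw [← hdim, ←
        (volume : Measure
          (EuclideanSpace ℝ (Fin 3))).measurePreserving_homeomorphUnitSphereProd.integral_comp
        (Homeomorph.measurableEmbedding _)]
      refine integral_congr_ae (.of_forall fun x => ?_)
      have h' := h (homeomorphUnitSphereProd _ x).1 (homeomorphUnitSphereProd _ x).2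
        (homeomorphUnitSphereProd _ x).2.2
      dsimp only
      rw [← h', ← homeomorphUnitSphereProd_symm_apply_coe,
        Homeomorph.symm_apply_apply]
    _ = (∫ ξ, f ξ ∂surfaceMeasure) * ∫ r : Set.Ioi (0 : ℝ), g r ∂.volumeIoiPow 2 :=
      integral_prod_mul f (fun r : Set.Ioi (0 : ℝ) => g r)
    _ = _ := by
      congr 1
      simp only [Measure.volumeIoiPow, ENNReal.ofReal]
      rw [integral_withDensity_eq_integral_smul,
        integral_subtype_comap measurableSet_Ioi fun a ↦ Real.toNNReal (a ^ 2) • g a,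
        setIntegral_congr_fun measurableSet_Ioi fun x hx ↦ ?_]
      · rw [NNReal.smul_def, Real.coe_toNNReal _ (sq_nonneg _), smul_eq_mul]
      · exact (measurable_subtype_coe.pow_const _).real_toNNReal

theorem integral_Ioi_pow_mul_exp_neg_sq (n : ℕ) :
    ∫ t in Set.Ioi (0 : ℝ), t ^ n * Real.exp (-t ^ 2) = Real.Gamma ((n + 1) / 2) / 2 := by
  have h := integral_rpow_mul_exp_neg_rpow (p := 2) (q := n) two_pos
    (by linarith [n.cast_nonneg (α := ℝ)])
  simp only [Real.rpow_natCast, Real.rpow_two] at h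
  rw [h]
  ring

theorem integral_even_pow_mul_exp_neg_sq (k : ℕ) :
    ∫ t : ℝ, t ^ (2 * k) * Real.exp (-t ^ 2) = Real.Gamma (k + 1 / 2) := by
  have h := integral_comp_abs (f := fun t : ℝ => t ^ (2 * k) * Real.exp (-t ^ 2))
  simp only [sq_abs, pow_mul] at h
  simp only [← pow_mul] at h
  rw [h, integral_Ioi_pow_mul_exp_neg_sq, mul_div_cancel₀ _ two_ne_zero]
  congr 1
  push_cast
  ring

/-- The even moments of a coordinate on the sphere, obtained by integrating
`x₂ ^ (2 k) exp (-‖x‖²)` over `ℝ³` both in Cartesian and in polar coordinates. -/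
theorem integral_cosColat_pow_even (k : ℕ) :
    ∫ ξ, cosColat ξ ^ (2 * k) ∂surfaceMeasure = 4 * Real.pi / (2 * k + 1) := by
  have hpolar := integral_mul_radial (fun x => x 2 ^ (2 * k) * Real.exp (-‖x‖ ^ 2))
    (fun ξ => cosColat ξ ^ (2 * k)) (fun r => r ^ (2 * k) * Real.exp (-r ^ 2)) (by
      intro ξ r hr
      have : ‖(ξ : EuclideanSpace ℝ (Fin 3))‖ = 1 := by simp
      simp only [PiLp.smul_apply, smul_eq_mul, norm_smul, this, mul_one, Real.norm_eq_abs, sq_abs,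
        cosColat]
      ring)
  have hcart : ∫ x : EuclideanSpace ℝ (Fin 3), x 2 ^ (2 * k) * Real.exp (-‖x‖ ^ 2) =
      Real.Gamma (k + 1 / 2) * Real.pi := by
    rw [← (PiLp.volume_preserving_toLp (Fin 3)).integral_comp
      (MeasurableEquiv.toLp 2 _).measurableEmbedding]
    have hprod := integral_fin_nat_prod_volume_eq_prod (𝕜 := ℝ) (n := 3) (E := fun _ => ℝ)
      ![fun t => Real.exp (-t ^ 2), fun t => Real.exp (-t ^ 2),
        fun t => t ^ (2 * k) * Real.exp (-t ^ 2)]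
    have hg : ∫ t : ℝ, Real.exp (-t ^ 2) = Real.sqrt Real.pi := by
      simpa using integral_gaussian 1
    simp only [Fin.prod_univ_three, Matrix.cons_val_zero, Matrix.cons_val_one,
      Matrix.cons_val, integral_even_pow_mul_exp_neg_sq, hg] at hprod
    rw [Real.mul_self_sqrt Real.pi_pos.le, mul_comm Real.pi] at hprod
    rw [← hprod]
    refine integral_congr_ae (.of_forall fun x => ?_)
    simp only [EuclideanSpace.norm_sq_eq, Fin.sum_univ_three, Real.norm_eq_abs, sq_abs, neg_add,
      Real.exp_add]
    ring
  have hrad : ∫ r in Set.Ioi (0 : ℝ), r ^ 2 * (r ^ (2 * k) * Real.exp (-r ^ 2)) =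
      (k + 1 / 2) * Real.Gamma (k + 1 / 2) / 2 := by
    have := integral_Ioi_pow_mul_exp_neg_sq (2 + 2 * k)
    simp only [pow_add, mul_assoc] at this
    rw [this, ← Real.Gamma_add_one (by positivity)]
    congr 2
    push_cast
    ring
  rw [hcart, hrad] at hpolar
  have hG : Real.Gamma (k + 1 / 2) ≠ 0 := (Real.Gamma_pos_of_pos (by positivity)).ne'
  rw [eq_div_iff (by positivity)]
  apply mul_left_cancel₀ hG
  linear_combination -4 * hpolar

theorem continuous_cosColat : Continuous cosColat := by
  unfold cosColat; fun_prop

/-- Archimedes' theorem: the height on the sphere is uniformly distributed on `[-1, 1]`. -/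
theorem integral_eval_cosColat (p : ℝ[X]) :
    ∫ ξ, p.eval (cosColat ξ) ∂surfaceMeasure = 2 * Real.pi * intervalFunctional p := by
  have hint (p : ℝ[X]) : Integrable (fun ξ : S2 => p.eval (cosColat ξ)) surfaceMeasure :=
    integrable_of_continuous (p.continuous.comp continuous_cosColat)
  induction p using Polynomial.induction_on' with
  | add p q hp hq =>
    simp only [eval_add, map_add, mul_add]
    rw [integral_add (hint p) (hint q), hp, hq]
  | monomial n a =>
    have hmom : ∫ ξ, cosColat ξ ^ n ∂surfaceMeasure =
        2 * Real.pi * intervalFunctional (X ^ n) := by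
      rw [intervalFunctional_X_pow]
      rcases n.even_or_odd' with ⟨k, rfl | rfl⟩
      · rw [integral_cosColat_pow_even, pow_succ, pow_mul]
        push_cast
        norm_num
        ring
      · have h := integral_comp_sphereMap (LinearIsometryEquiv.neg ℝ)
          (f := fun ξ => cosColat ξ ^ (2 * k + 1)) (continuous_cosColat.pow (2 * k + 1))
        have hneg (ξ : S2) : cosColat (sphereMap (LinearIsometryEquiv.neg ℝ) ξ) = -cosColat ξ := by
          simp [cosColat]
        simp only [hneg, Odd.neg_pow (odd_two_mul_add_one k), integral_neg] at h
        have h0 : ∫ ξ, cosColat ξ ^ (2 * k + 1) ∂surfaceMeasure = 0 := by linarith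
        rw [h0, show 2 * k + 1 + 1 = 2 * (k + 1) by ring, pow_mul]
        simp
    rw [← C_mul_X_pow_eq_monomial, ← smul_eq_C_mul, map_smul]
    simp only [eval_smul, eval_pow, eval_X, smul_eq_mul]
    rw [integral_const_mul, hmom]
    ring

/-! ### Spherical harmonics as restrictions of polynomials -/

theorem continuous_equatorial : Continuous equatorial := by
  have : equatorial = fun ξ : S2 => ((ξ.1 0 : ℝ) : ℂ) + ((ξ.1 1 : ℝ) : ℂ) * Complex.I := by
    funext ξ
    exact Complex.mk_eq_add_mul_I _ _
  rw [this]
  fun_prop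

/-- The function `x + i y` on the sphere. -/
noncomputable def equatorialMap : C(S2, ℂ) := ⟨equatorial, continuous_equatorial⟩

/-- The zonal function `ξ ↦ q (cos θ)` of a real polynomial `q`. -/
noncomputable def zonal : ℝ[X] →ₗ[ℝ] C(S2, ℂ) where
  toFun q := ⟨fun ξ => ((q.eval (cosColat ξ) : ℝ) : ℂ),
    Complex.continuous_ofReal.comp (q.continuous.comp continuous_cosColat)⟩
  map_add' p q := by ext ξ; simp
  map_smul' c q := by ext ξ; simp

@[simp]
theorem zonal_apply (q : ℝ[X]) (ξ : S2) : zonal q ξ = ((q.eval (cosColat ξ) : ℝ) : ℂ) := rfl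

theorem zonal_mul (p q : ℝ[X]) : zonal (p * q) = zonal p * zonal q := by ext ξ; simp

theorem zonal_one : zonal 1 = 1 := by ext ξ; simp

theorem zonal_pow (p : ℝ[X]) (n : ℕ) : zonal (p ^ n) = zonal p ^ n := by ext ξ; simp

theorem star_zonal (p : ℝ[X]) : star (zonal p) = zonal p := by ext ξ; simp

theorem equatorialMap_mul_star : equatorialMap * star equatorialMap = zonal (1 - X ^ 2) := by
  ext ξ
  have hn : (0 : ℝ) ≤ 1 - cosColat ξ ^ 2 := by
    have h : ‖ξ.1‖ ^ 2 = 1 := by simp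
    rw [EuclideanSpace.norm_sq_eq] at h
    simp only [Fin.sum_univ_three, Real.norm_eq_abs, sq_abs] at h
    simp only [cosColat]
    nlinarith [sq_nonneg (ξ.1 0), sq_nonneg (ξ.1 1)]
  have h : equatorial ξ * (starRingEnd ℂ) (equatorial ξ) = ((1 - cosColat ξ ^ 2 : ℝ) : ℂ) := by
    rw [Complex.mul_conj, Complex.normSq_eq_norm_sq, norm_equatorial, Real.sq_sqrt hn]
  simpa [equatorialMap] using h

/-- The function `sin^{|m|} θ e^{imφ}`: a power of `x + i y` or of its conjugate, according to the
sign of `m`. -/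
noncomputable def sectoral : ℤ → C(S2, ℂ)
  | Int.ofNat n => equatorialMap ^ n
  | Int.negSucc n => star equatorialMap ^ (n + 1)

theorem sectoral_apply (m : ℤ) (ξ : S2) : sectoral m ξ =
    (if 0 ≤ m then equatorial ξ else (starRingEnd ℂ) (equatorial ξ)) ^ m.natAbs := by
  rcases m with n | n <;> simp [sectoral, equatorialMap]

theorem sectoral_mul_equatorialMap (m : ℤ) :
    (∃ m' : ℤ, m'.natAbs ≤ m.natAbs + 1 ∧ sectoral m * equatorialMap = sectoral m') ∨
    (∃ m' : ℤ, m'.natAbs + 1 = m.natAbs ∧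
      sectoral m * equatorialMap = sectoral m' * zonal (1 - X ^ 2)) := by
  rcases m with n | _ | n
  · exact .inl ⟨Int.ofNat (n + 1), le_rfl, rfl⟩
  · exact .inr ⟨0, rfl, by
      rw [← equatorialMap_mul_star]
      change _ = equatorialMap ^ 0 * _
      simp only [sectoral]
      ring⟩
  · exact .inr ⟨Int.negSucc n, rfl, by rw [← equatorialMap_mul_star]; simp only [sectoral]; ring⟩

theorem sectoral_mul_star_equatorialMap (m : ℤ) :
    (∃ m' : ℤ, m'.natAbs ≤ m.natAbs + 1 ∧ sectoral m * star equatorialMap = sectoral m') ∨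
    (∃ m' : ℤ, m'.natAbs + 1 = m.natAbs ∧
      sectoral m * star equatorialMap = sectoral m' * zonal (1 - X ^ 2)) := by
  rcases m with (_ | n) | n
  · exact .inl ⟨Int.negSucc 0, le_rfl, by simp [sectoral]⟩
  · exact .inr ⟨Int.ofNat n, rfl, by rw [← equatorialMap_mul_star]; simp only [sectoral]; ring⟩
  · exact .inl ⟨Int.negSucc (n + 1), le_rfl, rfl⟩

theorem star_sectoral_mul_sectoral (m : ℤ) :
    star (sectoral m) * sectoral m = zonal ((1 - X ^ 2) ^ m.natAbs) := by
  rw [zonal_pow, ← equatorialMap_mul_star]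
  rcases m with n | n <;> simp [sectoral, mul_pow, mul_comm]

/-- Up to a nonzero constant, `Y_{ℓm}` is `sin^{|m|} θ e^{imφ} P_ℓ^{(|m|)}(cos θ)`. -/
theorem exists_sphericalHarmonic_eq (ℓ : ℕ) (m : ℤ) :
    ∃ c : ℂ, c ≠ 0 ∧ sphericalHarmonic ℓ m =
      c • (sectoral m * zonal (derivative^[m.natAbs] (legendreP ℓ))) := by
  refine ⟨(harmonicConst ℓ m : ℂ) *
        (((if 0 ≤ m then (1 : ℝ) else (-1) ^ m.natAbs * ((Nat.factorial (ℓ - m.natAbs) : ℝ) /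
          (Nat.factorial (ℓ + m.natAbs) : ℝ))) * (-1) ^ m.natAbs : ℝ) : ℂ), ?_, ?_⟩
  · have h1 : harmonicConst ℓ m ≠ 0 := by
      rw [harmonicConst]
      exact (Real.sqrt_pos.2 (by positivity)).ne'
    have h2 : ((if 0 ≤ m then (1 : ℝ) else (-1) ^ m.natAbs *
        ((Nat.factorial (ℓ - m.natAbs) : ℝ) / (Nat.factorial (ℓ + m.natAbs) : ℝ))) *
          (-1) ^ m.natAbs : ℝ) ≠ 0 := by
      split_ifs <;> positivity
    exact mul_ne_zero (Complex.ofReal_ne_zero.2 h1) (Complex.ofReal_ne_zero.2 h2)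
  · ext ξ
    rw [ContinuousMap.smul_apply, ContinuousMap.mul_apply, sectoral_apply, zonal_apply,
      ← sqrt_pow_mul_exp]
    change sphericalHarmonicFun ℓ m ξ = _
    rw [sphericalHarmonicFun, assocLegendre, assocLegendreNat]
    split_ifs <;> simp only [smul_eq_mul] <;> push_cast <;> ring

theorem sectoral_mul_zonal_mem_harmonicFun {ℓ : ℕ} {m : ℤ} (hm : m.natAbs ≤ ℓ) :
    sectoral m * zonal (derivative^[m.natAbs] (legendreP ℓ)) ∈ harmonicFun ℓ := by
  obtain ⟨c, hc, h⟩ := exists_sphericalHarmonic_eq ℓ m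
  have hmem : sphericalHarmonic ℓ m ∈ harmonicFun ℓ :=
    Submodule.subset_span ⟨m, ⟨by omega, by omega⟩, rfl⟩
  rw [h] at hmem
  exact ((harmonicFun ℓ).smul_mem_iff hc).1 hmem

theorem harmonicFun_le {ℓ : ℕ} {U : Submodule ℂ C(S2, ℂ)}
    (h : ∀ m : ℤ, m.natAbs ≤ ℓ → sectoral m * zonal (derivative^[m.natAbs] (legendreP ℓ)) ∈ U) :
    harmonicFun ℓ ≤ U := by
  refine Submodule.span_le.2 ?_
  rintro _ ⟨m, ⟨h1, h2⟩, rfl⟩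
  have hm : m.natAbs ≤ ℓ := by omega
  obtain ⟨c, -, hc⟩ := exists_sphericalHarmonic_eq ℓ m
  rw [hc]
  exact U.smul_mem c (h m hm)

/-- The restrictions to the sphere of the complex polynomials of degree at most one in `x`, `y`,
`z`. Its powers consist of the restrictions of the polynomials of bounded degree. -/
noncomputable def affineFun : Submodule ℂ C(S2, ℂ) :=
  Submodule.span ℂ {1, equatorialMap, star equatorialMap, zonal X}

theorem one_le_affineFun : 1 ≤ affineFun :=
  Submodule.one_le.2 (Submodule.subset_span (by simp))

theorem affineFun_pow_mono : Monotone fun n : ℕ => affineFun ^ n :=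
  monotone_nat_of_le_succ fun n f hf => by
    have h := Submodule.mul_mem_mul hf (Submodule.one_le.1 one_le_affineFun)
    rwa [mul_one] at h

theorem mul_mem_affineFun_pow {a b : ℕ} {f g : C(S2, ℂ)} (hf : f ∈ affineFun ^ a)
    (hg : g ∈ affineFun ^ b) : f * g ∈ affineFun ^ (a + b) := by
  have h := pow_add (M := @Submodule ℂ C(S2, ℂ) _ _ Algebra.toModule) affineFun a b
  exact h.ge (Submodule.mul_mem_mul hf hg)

theorem sectoral_mem_affineFun_pow (m : ℤ) : sectoral m ∈ affineFun ^ m.natAbs := by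
  rcases m with n | n
  · exact Submodule.pow_mem_pow _ (Submodule.subset_span (by simp)) n
  · exact Submodule.pow_mem_pow _ (Submodule.subset_span (by simp)) (n + 1)

theorem zonal_mem_affineFun_pow {q : ℝ[X]} {n : ℕ} (h : q.natDegree ≤ n) :
    zonal q ∈ affineFun ^ n := by
  rw [q.as_sum_range_C_mul_X_pow, map_sum]
  refine Submodule.sum_mem _ fun i hi => ?_
  have hX : zonal (X ^ i) ∈ affineFun ^ i := by
    rw [zonal_pow]
    exact Submodule.pow_mem_pow _ (Submodule.subset_span (by simp)) i
  have hs : zonal (C (q.coeff i) * X ^ i) = (q.coeff i : ℂ) • zonal (X ^ i) := by ext ξ; simp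
  rw [hs]
  exact Submodule.smul_mem _ _
    (affineFun_pow_mono (by rw [Finset.mem_range] at hi; omega) hX)

theorem harmonicFun_le_affineFun_pow (ℓ : ℕ) : harmonicFun ℓ ≤ affineFun ^ ℓ := by
  refine harmonicFun_le fun m hm => ?_
  have h := mul_mem_affineFun_pow (sectoral_mem_affineFun_pow m)
    (zonal_mem_affineFun_pow (natDegree_iterate_derivative_legendreP ℓ m.natAbs).le)
  rwa [Nat.add_sub_cancel' hm] at h

/-- Polynomials on the sphere in the adapted form `sin^{|m|} θ e^{imφ} q(cos θ)`, which uses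
`x² + y² = 1 - z²` to eliminate the mixed products of `x + i y` and `x - i y`. -/
noncomputable def reducedFun (n : ℕ) : Submodule ℂ C(S2, ℂ) :=
  Submodule.span ℂ {f | ∃ (m : ℤ) (q : ℝ[X]), m.natAbs + q.natDegree ≤ n ∧
    f = sectoral m * zonal q}

theorem affineFun_pow_le_reducedFun (n : ℕ) : affineFun ^ n ≤ reducedFun n := by
  induction n with
  | zero =>
    rw [Submodule.pow_zero, Submodule.one_le]
    exact Submodule.subset_span ⟨0, 1, by simp, by rw [zonal_one]; ext; simp [sectoral_apply]⟩
  | succ n ih =>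
    rw [Submodule.pow_succ]
    refine (mul_le_mul_left ih _).trans ?_
    rw [reducedFun, affineFun, Submodule.span_mul_span]
    refine Submodule.span_mono ?_
    rintro _ ⟨_, ⟨m, q, hmq, rfl⟩, g, hg, rfl⟩
    have hdeg : ((1 - X ^ 2 : ℝ[X]) * q).natDegree ≤ 2 + q.natDegree := by
      refine natDegree_mul_le.trans (Nat.add_le_add_right ?_ _)
      rw [← C_1, natDegree_sub, natDegree_X_pow_sub_C]
    simp only [Set.mem_insert_iff, Set.mem_singleton_iff] at hg
    rcases hg with rfl | rfl | rfl | rfl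
    · exact ⟨m, q, by omega, by simp⟩
    · rcases sectoral_mul_equatorialMap m with ⟨m', hm', h⟩ | ⟨m', hm', h⟩
      · exact ⟨m', q, by omega, by rw [← h]; dsimp only; ring⟩
      · exact ⟨m', (1 - X ^ 2) * q, by omega, by rw [zonal_mul, ← mul_assoc, ← h]; dsimp only; ring⟩
    · rcases sectoral_mul_star_equatorialMap m with ⟨m', hm', h⟩ | ⟨m', hm', h⟩
      · exact ⟨m', q, by omega, by rw [← h]; dsimp only; ring⟩
      · exact ⟨m', (1 - X ^ 2) * q, by omega, by rw [zonal_mul, ← mul_assoc, ← h]; dsimp only; ring⟩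
    · refine ⟨m, q * X, ?_, by rw [zonal_mul, ← mul_assoc]⟩
      have := natDegree_mul_le (p := q) (q := X)
      rw [natDegree_X] at this
      omega

theorem sectoral_mul_zonal_mem_iSup {n : ℕ} (m : ℤ) (k : ℕ) {q : ℝ[X]} (hq : q.degree < k)
    (hn : m.natAbs + k ≤ n + 1) :
    sectoral m * zonal q ∈ ⨆ ℓ ∈ Set.Iic n, harmonicFun ℓ := by
  induction k generalizing q with
  | zero =>
    have hq0 : q = 0 := by
      rw [degree_lt_iff_coeff_zero] at hq
      ext i
      exact hq i i.zero_le
    simp [hq0]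
  | succ k ih =>
    -- Subtract the multiple of the `m`-th derivative of `P_{|m|+k}` with the same leading term.
    set a := derivative^[m.natAbs] (legendreP (m.natAbs + k)) with ha
    have hak : a.natDegree = k := by
      rw [ha, natDegree_iterate_derivative_legendreP, Nat.add_sub_cancel_left]
    have ha0 : a.coeff k ≠ 0 := by
      rw [← hak]
      exact leadingCoeff_ne_zero.2 (iterate_derivative_legendreP_ne_zero (Nat.le_add_right _ _))
    set c := q.coeff k / a.coeff k with hc
    have hrest : (q - C c * a).degree < k := by
      rw [degree_lt_iff_coeff_zero] at hq ⊢
      intro i hi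
      rw [coeff_sub, coeff_C_mul]
      rcases hi.eq_or_lt with rfl | hi
      · rw [hc, div_mul_cancel₀ _ ha0, sub_self]
      · rw [hq i hi, coeff_eq_zero_of_natDegree_lt (by omega), mul_zero, sub_zero]
    have hsplit : sectoral m * zonal q =
        sectoral m * zonal (q - C c * a) + (c : ℂ) • (sectoral m * zonal a) := by
      ext ξ
      simp
      ring
    rw [hsplit]
    refine Submodule.add_mem _ (ih hrest (by omega)) (Submodule.smul_mem _ _ ?_)
    exact Submodule.mem_iSup_of_mem (m.natAbs + k) (Submodule.mem_iSup_of_mem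
      (by rw [Set.mem_Iic]; omega) (sectoral_mul_zonal_mem_harmonicFun (Nat.le_add_right _ _)))

/-- The spherical harmonics of degree at most `n` span the polynomials of degree at most `n`. -/
theorem iSup_harmonicFun (n : ℕ) : ⨆ ℓ ∈ Set.Iic n, harmonicFun ℓ = affineFun ^ n := by
  refine le_antisymm (iSup₂_le fun ℓ hℓ =>
    (harmonicFun_le_affineFun_pow ℓ).trans (affineFun_pow_mono hℓ)) ?_
  refine (affineFun_pow_le_reducedFun n).trans (Submodule.span_le.2 ?_)
  rintro _ ⟨m, q, h, rfl⟩
  refine sectoral_mul_zonal_mem_iSup m (q.natDegree + 1) ?_ (by omega)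
  exact degree_lt_iff_coeff_zero _ _ |>.2 fun i hi => coeff_eq_zero_of_natDegree_lt (by omega)

/-! ### Orthogonality of the spherical harmonics -/

theorem inner_toL2 (f g : C(S2, ℂ)) :
    inner ℂ (toL2 f) (toL2 g) = ∫ ξ, (starRingEnd ℂ) (f ξ) * g ξ ∂surfaceMeasure := by
  rw [ContinuousMap.inner_toLp]
  simp only [mul_comm]

/-- The pull-back of functions along an isometry of the sphere. -/
noncomputable def pullback (R : EuclideanSpace ℝ (Fin 3) ≃ₗᵢ[ℝ] EuclideanSpace ℝ (Fin 3)) :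
    C(S2, ℂ) →ₗ[ℂ] C(S2, ℂ) where
  toFun f := f.comp (sphereMap R)
  map_add' f g := by ext; simp
  map_smul' c f := by ext; simp

@[simp]
theorem pullback_apply (R : EuclideanSpace ℝ (Fin 3) ≃ₗᵢ[ℝ] EuclideanSpace ℝ (Fin 3))
    (f : C(S2, ℂ)) (ξ : S2) : pullback R f ξ = f (sphereMap R ξ) := rfl

theorem inner_pullback (R : EuclideanSpace ℝ (Fin 3) ≃ₗᵢ[ℝ] EuclideanSpace ℝ (Fin 3))
    (f g : C(S2, ℂ)) :
    inner ℂ (toL2 (pullback R f)) (toL2 (pullback R g)) = inner ℂ (toL2 f) (toL2 g) := by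
  rw [inner_toL2, inner_toL2]
  exact integral_comp_sphereMap R (f := fun ξ => (starRingEnd ℂ) (f ξ) * g ξ)
    ((Complex.continuous_conj.comp f.continuous).mul g.continuous)

/-- The rotation of `ℝ³` by the angle `θ` about the third axis. -/
noncomputable def axialRotation (θ : ℝ) :
    EuclideanSpace ℝ (Fin 3) ≃ₗᵢ[ℝ] EuclideanSpace ℝ (Fin 3) :=
  LinearIsometry.toLinearIsometryEquiv
    { toFun := fun x => !₂[Real.cos θ * x 0 - Real.sin θ * x 1,
        Real.sin θ * x 0 + Real.cos θ * x 1, x 2]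
      map_add' := fun x y => by ext i; fin_cases i <;> simp <;> ring
      map_smul' := fun c x => by ext i; fin_cases i <;> simp <;> ring
      norm_map' := fun x => by
        simp only [LinearMap.coe_mk, AddHom.coe_mk, EuclideanSpace.norm_eq, Fin.sum_univ_three,
          Real.norm_eq_abs, sq_abs]
        congr 1
        simp
        linear_combination (x 0 ^ 2 + x 1 ^ 2) * Real.sin_sq_add_cos_sq θ } rfl

theorem equatorial_axialRotation (θ : ℝ) (ξ : S2) :
    equatorial (sphereMap (axialRotation θ) ξ) = Complex.exp (θ * Complex.I) * equatorial ξ := by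
  rw [Complex.exp_mul_I, ← Complex.ofReal_cos, ← Complex.ofReal_sin]
  apply Complex.ext <;>
    simp [equatorial, axialRotation, -Complex.ofReal_cos, -Complex.ofReal_sin]
  ring

theorem pullback_axialRotation (θ : ℝ) (m : ℤ) (q : ℝ[X]) :
    pullback (axialRotation θ) (sectoral m * zonal q) =
      Complex.exp (m * (θ * Complex.I)) • (sectoral m * zonal q) := by
  ext ξ
  have hz : cosColat (sphereMap (axialRotation θ) ξ) = cosColat ξ := by
    simp [cosColat, axialRotation]
  simp only [pullback_apply, ContinuousMap.mul_apply, ContinuousMap.smul_apply, zonal_apply, hz,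
    smul_eq_mul, sectoral_apply, equatorial_axialRotation, map_mul, ← Complex.exp_conj,
    Complex.conj_ofReal, Complex.conj_I, ← mul_assoc]
  congr 1
  obtain ⟨n, rfl | rfl⟩ := m.eq_nat_or_neg
  · simp [mul_pow, ← Complex.exp_nat_mul, mul_assoc]
  · rcases Nat.eq_zero_or_pos n with rfl | hn
    · simp
    · rw [if_neg (by omega), if_neg (by omega), mul_pow, ← Complex.exp_nat_mul]
      simp [mul_assoc]

theorem inner_sectoral_mul_zonal_of_ne {m m' : ℤ} (h : m ≠ m') (q q' : ℝ[X]) :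
    inner ℂ (toL2 (sectoral m * zonal q)) (toL2 (sectoral m' * zonal q')) = 0 := by
  -- The rotation by `π / (m' - m)` changes the sign of the inner product.
  have hk : ((m' : ℂ) - m) ≠ 0 := by
    rw [sub_ne_zero]
    exact_mod_cast h.symm
  set θ : ℝ := Real.pi / ((m' : ℝ) - m) with hθ
  have hinv := inner_pullback (axialRotation θ) (sectoral m * zonal q) (sectoral m' * zonal q')
  rw [pullback_axialRotation, pullback_axialRotation, map_smul, map_smul, inner_smul_left,
    inner_smul_right, ← mul_assoc, ← Complex.exp_conj, ← Complex.exp_add] at hinv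
  have hexp : (starRingEnd ℂ) ((m : ℂ) * (θ * Complex.I)) + (m' : ℂ) * (θ * Complex.I) =
      Real.pi * Complex.I := by
    simp only [map_mul, Complex.conj_ofReal, Complex.conj_I, map_intCast, hθ]
    push_cast
    field_simp
    ring
  rw [hexp, Complex.exp_pi_mul_I] at hinv
  linear_combination -(1 / 2 : ℂ) * hinv

theorem inner_sectoral_mul_zonal (m : ℤ) (q q' : ℝ[X]) :
    inner ℂ (toL2 (sectoral m * zonal q)) (toL2 (sectoral m * zonal q')) =
      ((2 * Real.pi * intervalFunctional ((1 - X ^ 2) ^ m.natAbs * (q * q')) : ℝ) : ℂ) := by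
  rw [inner_toL2, ← integral_eval_cosColat, ← integral_complex_ofReal]
  refine integral_congr_ae (.of_forall fun ξ => ?_)
  have h := congrArg (fun f : C(S2, ℂ) => f ξ) (star_sectoral_mul_sectoral m)
  simp only [ContinuousMap.mul_apply, ContinuousMap.star_apply, RCLike.star_def] at h
  rw [zonal_apply] at h
  simp only [ContinuousMap.mul_apply, map_mul, zonal_apply, Complex.conj_ofReal, eval_mul,
    Complex.ofReal_mul]
  rw [← h]
  ring

theorem inner_toL2_eq_zero_of_forall {ℓ : ℕ} {u : SphereL2}
    (h : ∀ m : ℤ, m.natAbs ≤ ℓ →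
      inner ℂ u (toL2 (sectoral m * zonal (derivative^[m.natAbs] (legendreP ℓ)))) = 0)
    {f : C(S2, ℂ)} (hf : f ∈ harmonicFun ℓ) : inner ℂ u (toL2 f) = 0 := by
  have hle : harmonicFun ℓ ≤ ((ℂ ∙ u)ᗮ).comap (toL2 : C(S2, ℂ) →ₗ[ℂ] SphereL2) :=
    harmonicFun_le fun m hm => Submodule.mem_orthogonal_singleton_iff_inner_right.2 (h m hm)
  exact Submodule.mem_orthogonal_singleton_iff_inner_right.1 (hle hf)

theorem inner_harmonicFun_of_lt {ℓ ℓ' : ℕ} (h : ℓ < ℓ') {f g : C(S2, ℂ)}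
    (hf : f ∈ harmonicFun ℓ) (hg : g ∈ harmonicFun ℓ') : inner ℂ (toL2 f) (toL2 g) = 0 := by
  refine inner_toL2_eq_zero_of_forall (fun m' _ => ?_) hg
  rw [inner_eq_zero_symm]
  refine inner_toL2_eq_zero_of_forall (fun m hm => ?_) hf
  rw [inner_eq_zero_symm]
  rcases eq_or_ne m m' with rfl | hne
  · rw [inner_sectoral_mul_zonal, intervalFunctional_iterate_derivative_legendreP hm h]
    simp
  · exact inner_sectoral_mul_zonal_of_ne hne _ _

theorem inner_harmonicFun_of_ne {ℓ ℓ' : ℕ} (h : ℓ ≠ ℓ') {f g : C(S2, ℂ)}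
    (hf : f ∈ harmonicFun ℓ) (hg : g ∈ harmonicFun ℓ') : inner ℂ (toL2 f) (toL2 g) = 0 := by
  rcases h.lt_or_gt with h | h
  · exact inner_harmonicFun_of_lt h hf hg
  · rw [inner_eq_zero_symm]
    exact inner_harmonicFun_of_lt h hg hf

theorem inner_eq_zero_of_mem_iSup {s : Set ℕ} {u : SphereL2}
    (h : ∀ ℓ ∈ s, ∀ g ∈ harmonicFun ℓ, inner ℂ u (toL2 g) = 0) {g : C(S2, ℂ)}
    (hg : g ∈ ⨆ ℓ ∈ s, harmonicFun ℓ) : inner ℂ u (toL2 g) = 0 := by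
  have hle : ⨆ ℓ ∈ s, harmonicFun ℓ ≤
      ((ℂ ∙ u)ᗮ).comap (toL2 : C(S2, ℂ) →ₗ[ℂ] SphereL2) :=
    iSup₂_le fun ℓ hℓ g hg => Submodule.mem_orthogonal_singleton_iff_inner_right.2 (h ℓ hℓ g hg)
  exact Submodule.mem_orthogonal_singleton_iff_inner_right.1 (hle hg)

/-- Spherical harmonics of degree `ℓ` are orthogonal to all polynomials of lower degree. -/
theorem inner_affineFun_pow_of_lt {n ℓ : ℕ} (h : n < ℓ) {f g : C(S2, ℂ)}
    (hf : f ∈ harmonicFun ℓ) (hg : g ∈ affineFun ^ n) : inner ℂ (toL2 f) (toL2 g) = 0 := by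
  rw [← iSup_harmonicFun] at hg
  exact inner_eq_zero_of_mem_iSup
    (fun l hl g hg => inner_harmonicFun_of_ne (by rw [Set.mem_Iic] at hl; omega) hf hg) hg

/-! ### Rotation invariance -/

theorem mem_affineFun_of_linear (L : EuclideanSpace ℝ (Fin 3) →ₗ[ℝ] ℂ) {f : C(S2, ℂ)}
    (hf : ∀ ξ : S2, f ξ = L ξ) : f ∈ affineFun := by
  set e := fun i : Fin 3 => L (EuclideanSpace.single i 1) with he
  have hL (x : EuclideanSpace ℝ (Fin 3)) : L x = x 0 * e 0 + x 1 * e 1 + x 2 * e 2 := by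
    conv_lhs => rw [← (EuclideanSpace.basisFun (Fin 3) ℝ).sum_repr x]
    simp [Fin.sum_univ_three, he]
  have hfe : f = ((e 0 - Complex.I * e 1) / 2) • equatorialMap +
      ((e 0 + Complex.I * e 1) / 2) • star equatorialMap + e 2 • zonal X := by
    ext ξ
    have h1 : equatorialMap ξ = (ξ.1 0 : ℂ) + (ξ.1 1 : ℂ) * Complex.I :=
      Complex.mk_eq_add_mul_I _ _
    simp only [ContinuousMap.add_apply, ContinuousMap.smul_apply, ContinuousMap.star_apply,
      smul_eq_mul, zonal_apply, eval_X, cosColat, h1, RCLike.star_def, map_add, map_mul,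
      Complex.conj_ofReal, Complex.conj_I, hf, hL]
    linear_combination (ξ.1 1 : ℂ) * e 1 * Complex.I_sq
  rw [hfe]
  refine add_mem (add_mem ?_ ?_) ?_ <;>
    exact Submodule.smul_mem _ _ (Submodule.subset_span (by simp))

theorem affineFun_le_comap_pullback
    (R : EuclideanSpace ℝ (Fin 3) ≃ₗᵢ[ℝ] EuclideanSpace ℝ (Fin 3)) :
    affineFun ≤ affineFun.comap (pullback R) := by
  refine Submodule.span_le.2 ?_
  have hw : pullback R equatorialMap ∈ affineFun := by
    let L : EuclideanSpace ℝ (Fin 3) →ₗ[ℝ] ℂ :=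
      { toFun := fun x => ⟨x 0, x 1⟩
        map_add' := fun x y => rfl
        map_smul' := fun c x => by apply Complex.ext <;> simp }
    exact mem_affineFun_of_linear (L ∘ₗ (R : _ →ₗ[ℝ] EuclideanSpace ℝ (Fin 3))) fun ξ => rfl
  have hw' : pullback R (star equatorialMap) ∈ affineFun := by
    let L : EuclideanSpace ℝ (Fin 3) →ₗ[ℝ] ℂ :=
      { toFun := fun x => ⟨x 0, -x 1⟩
        map_add' := fun x y => by apply Complex.ext <;> simp; ring
        map_smul' := fun c x => by apply Complex.ext <;> simp }
    exact mem_affineFun_of_linear (L ∘ₗ (R : _ →ₗ[ℝ] EuclideanSpace ℝ (Fin 3))) fun ξ => rfl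
  have hz : pullback R (zonal X) ∈ affineFun := by
    let L : EuclideanSpace ℝ (Fin 3) →ₗ[ℝ] ℂ :=
      { toFun := fun x => (x 2 : ℂ)
        map_add' := fun x y => by simp
        map_smul' := fun c x => by simp }
    exact mem_affineFun_of_linear (L ∘ₗ (R : _ →ₗ[ℝ] EuclideanSpace ℝ (Fin 3)))
      fun ξ => by simp [L, cosColat]
  have h1 : pullback R 1 ∈ affineFun := Submodule.one_le.1 one_le_affineFun
  rintro _ (rfl | rfl | rfl | rfl) <;> assumption

theorem affineFun_pow_le_comap_pullback
    (R : EuclideanSpace ℝ (Fin 3) ≃ₗᵢ[ℝ] EuclideanSpace ℝ (Fin 3)) (n : ℕ) :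
    affineFun ^ n ≤ (affineFun ^ n).comap (pullback R) := by
  induction n with
  | zero =>
    rw [Submodule.pow_zero, Submodule.one_le]
    exact (Submodule.one_le.1 (le_refl 1) : (1 : C(S2, ℂ)) ∈ (1 : Submodule ℂ C(S2, ℂ)))
  | succ n ih =>
    rw [Submodule.pow_succ, Submodule.mul_le]
    intro f hf g hg
    have hf' : pullback R f ∈ affineFun ^ n := ih hf
    have hg' : pullback R g ∈ affineFun := affineFun_le_comap_pullback R hg
    exact Submodule.mul_mem_mul hf' hg'

/-- The spherical harmonics of a given degree are invariant under isometries, being the orthogonal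
complement of the polynomials of lower degree in the polynomials of degree at most `ℓ`. -/
theorem pullback_mem_harmonicFun
    (R : EuclideanSpace ℝ (Fin 3) ≃ₗᵢ[ℝ] EuclideanSpace ℝ (Fin 3)) {ℓ : ℕ} {f : C(S2, ℂ)}
    (hf : f ∈ harmonicFun ℓ) : pullback R f ∈ harmonicFun ℓ := by
  have hmem := affineFun_pow_le_comap_pullback R ℓ (harmonicFun_le_affineFun_pow ℓ hf)
  rw [Submodule.mem_comap, ← iSup_harmonicFun, ← Set.Iio_insert, iSup_insert,
    Submodule.mem_sup] at hmem
  obtain ⟨y, hy, z, hz, hyz⟩ := hmem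
  have hortho (l : ℕ) (hl : l ∈ Set.Iio ℓ) (g : C(S2, ℂ)) (hg : g ∈ harmonicFun l) :
      inner ℂ (toL2 z) (toL2 g) = 0 := by
    have h1 : inner ℂ (toL2 y) (toL2 g) = 0 :=
      inner_harmonicFun_of_ne (ne_of_gt hl) hy hg
    have h2 : inner ℂ (toL2 (pullback R f)) (toL2 g) = 0 := by
      have hg' : g = pullback R (pullback R.symm g) := by ext ξ; simp
      rw [hg', inner_pullback]
      exact inner_affineFun_pow_of_lt hl hf
        (affineFun_pow_le_comap_pullback R.symm l (harmonicFun_le_affineFun_pow l hg))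
    rwa [← hyz, map_add, inner_add_left, h1, zero_add] at h2
  have hz0 : toL2 z = 0 := inner_self_eq_zero.1 (inner_eq_zero_of_mem_iSup hortho hz)
  have hz0 : z = 0 := ContinuousMap.toLp_injective surfaceMeasure (hz0.trans (map_zero _).symm)
  rw [← hyz, hz0, add_zero]
  exact hy

/-! ### The reproducing kernel -/

/-- The zonal function `ξ ↦ L_ℓ(ξ · η)` with pole `η`. -/
noncomputable def legendreKernel (ℓ : ℕ) (η : S2) : C(S2, ℂ) where
  toFun ξ := ((legendreL ℓ (inner ℝ (ξ : EuclideanSpace ℝ (Fin 3)) η) : ℝ) : ℂ)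
  continuous_toFun := Complex.continuous_ofReal.comp
    ((continuous_legendreL ℓ).comp (by fun_prop))

/-- The north pole. -/
noncomputable def northPole : S2 := ⟨EuclideanSpace.single 2 1, by simp⟩

theorem legendreKernel_northPole (ℓ : ℕ) : legendreKernel ℓ northPole =
    (((2 * ℓ + 1) / (4 * Real.pi) : ℝ) : ℂ) •
      (sectoral 0 * zonal (derivative^[(0 : ℤ).natAbs] (legendreP ℓ))) := by
  ext ξ
  have h : inner ℝ (ξ : EuclideanSpace ℝ (Fin 3)) northPole.1 = cosColat ξ := by
    rw [northPole, real_inner_comm, EuclideanSpace.inner_single_left]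
    simp [cosColat]
  simp [legendreKernel, legendreL, sectoral_apply, h]

theorem exists_sphereMap_northPole (η : S2) :
    ∃ R : EuclideanSpace ℝ (Fin 3) ≃ₗᵢ[ℝ] EuclideanSpace ℝ (Fin 3),
      sphereMap R northPole = η :=
  ⟨_, Subtype.ext (Submodule.reflection_sub (by simp))⟩

theorem legendreKernel_sphereMap
    (R : EuclideanSpace ℝ (Fin 3) ≃ₗᵢ[ℝ] EuclideanSpace ℝ (Fin 3)) (ℓ : ℕ) (η : S2) :
    pullback R (legendreKernel ℓ (sphereMap R η)) = legendreKernel ℓ η := by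
  ext ξ
  simp [legendreKernel]

theorem legendreKernel_mem_harmonicFun (ℓ : ℕ) (η : S2) :
    legendreKernel ℓ η ∈ harmonicFun ℓ := by
  obtain ⟨R, rfl⟩ := exists_sphereMap_northPole η
  have hN : legendreKernel ℓ northPole ∈ harmonicFun ℓ := by
    rw [legendreKernel_northPole]
    exact Submodule.smul_mem _ _ (sectoral_mul_zonal_mem_harmonicFun (by simp))
  have h := pullback_mem_harmonicFun R.symm hN
  rw [← legendreKernel_sphereMap R] at h
  convert h using 1
  ext ξ
  simp

theorem inner_legendreKernel_northPole {ℓ : ℕ} {f : C(S2, ℂ)} (hf : f ∈ harmonicFun ℓ) :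
    inner ℂ (toL2 (legendreKernel ℓ northPole)) (toL2 f) = f northPole := by
  let U : Submodule ℂ C(S2, ℂ) :=
    { carrier := {f | inner ℂ (toL2 (legendreKernel ℓ northPole)) (toL2 f) = f northPole}
      add_mem' := fun {f g} hf hg => by
        simp only [Set.mem_ofPred_eq] at hf hg ⊢
        rw [map_add, inner_add_right, hf, hg, ContinuousMap.add_apply]
      zero_mem' := by simp
      smul_mem' := fun c f hf => by
        simp only [Set.mem_ofPred_eq] at hf ⊢
        rw [map_smul, inner_smul_right, hf, ContinuousMap.smul_apply, smul_eq_mul] }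
  suffices harmonicFun ℓ ≤ U from this hf
  refine harmonicFun_le fun m _ => ?_
  have hpole : cosColat northPole = 1 := by simp [cosColat, northPole]
  change inner ℂ _ _ = _
  rw [legendreKernel_northPole, map_smul, inner_smul_left]
  rcases eq_or_ne 0 m with rfl | hm
  · rw [inner_sectoral_mul_zonal]
    simp only [Int.natAbs_zero, pow_zero, one_mul, Function.iterate_zero, id,
      intervalFunctional_legendreP_sq, ContinuousMap.mul_apply, zonal_apply, sectoral_apply, hpole,
      legendreP_eval_one, Complex.conj_ofReal]
    rw [← Complex.ofReal_mul, Complex.ofReal_one, ← Complex.ofReal_one]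
    congr 1
    have := Real.pi_pos
    field_simp
    norm_num
  · have hw : equatorial northPole = 0 := by
      apply Complex.ext <;> simp [equatorial, northPole]
    rw [inner_sectoral_mul_zonal_of_ne hm, mul_zero, ContinuousMap.mul_apply, sectoral_apply, hw]
    simp [hm.symm]

/-- The addition formula in the form used here: `L_ℓ(ξ · η)` is the reproducing kernel of the
spherical harmonics of degree `ℓ`. -/
theorem inner_legendreKernel {ℓ : ℕ} (η : S2) {f : C(S2, ℂ)} (hf : f ∈ harmonicFun ℓ) :
    inner ℂ (toL2 (legendreKernel ℓ η)) (toL2 f) = f η := by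
  obtain ⟨R, rfl⟩ := exists_sphereMap_northPole η
  rw [← inner_pullback R, legendreKernel_sphereMap,
    inner_legendreKernel_northPole (pullback_mem_harmonicFun R hf), pullback_apply]

theorem inner_legendreKernel_of_ne {ℓ ℓ' : ℕ} (h : ℓ ≠ ℓ') (η : S2) {f : C(S2, ℂ)}
    (hf : f ∈ harmonicFun ℓ') : inner ℂ (toL2 (legendreKernel ℓ η)) (toL2 f) = 0 :=
  inner_harmonicFun_of_ne h (legendreKernel_mem_harmonicFun ℓ η) hf

/-! ### Completeness of the spherical harmonics -/

theorem exists_mem_affineFun_pow_of_mem_adjoin {f : C(S2, ℂ)}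
    (hf : f ∈ StarAlgebra.adjoin ℂ ({equatorialMap, zonal X} : Set C(S2, ℂ))) :
    ∃ n, f ∈ affineFun ^ n := by
  have hf' : f ∈ Algebra.adjoin ℂ
      (({equatorialMap, zonal X} : Set C(S2, ℂ)) ∪ star {equatorialMap, zonal X}) := hf
  clear hf
  induction hf' using Algebra.adjoin_induction with
  | mem g hg =>
    refine ⟨1, ?_⟩
    rw [Submodule.pow_one]
    refine Submodule.subset_span ?_
    rcases hg with (rfl | rfl) | hg
    · simp
    · simp
    · rcases hg with hg | hg
      · simp [← hg]
      · simp [eq_star_of_eq_star (Set.mem_singleton_iff.1 hg).symm, star_zonal]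
  | algebraMap c =>
    refine ⟨0, ?_⟩
    rw [Algebra.algebraMap_eq_smul_one, Submodule.pow_zero]
    exact Submodule.smul_mem _ _ (Submodule.one_le.1 (le_refl (1 : Submodule ℂ C(S2, ℂ))))
  | add f g _ _ ihf ihg =>
    obtain ⟨a, ha⟩ := ihf
    obtain ⟨b, hb⟩ := ihg
    exact ⟨max a b, add_mem (affineFun_pow_mono (le_max_left a b) ha)
      (affineFun_pow_mono (le_max_right a b) hb)⟩
  | mul f g _ _ ihf ihg =>
    obtain ⟨a, ha⟩ := ihf
    obtain ⟨b, hb⟩ := ihg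
    exact ⟨a + b, mul_mem_affineFun_pow ha hb⟩

theorem toL2_mem_harmonicSpace {ℓ : ℕ} {f : C(S2, ℂ)} (hf : f ∈ harmonicFun ℓ) :
    toL2 f ∈ harmonicSpace ℓ :=
  Submodule.mem_map_of_mem hf

/-- By the Stone–Weierstrass theorem the spherical harmonics span a dense subspace. -/
theorem top_le_topologicalClosure_iSup_harmonicSpace :
    ⊤ ≤ (⨆ ℓ, harmonicSpace ℓ).topologicalClosure := by
  set A := StarAlgebra.adjoin ℂ ({equatorialMap, zonal X} : Set C(S2, ℂ)) with hA
  have hsep : A.toSubalgebra.SeparatesPoints := by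
    intro ξ η hne
    by_contra! h
    have hw : equatorial ξ = equatorial η :=
      h _ ⟨equatorialMap, StarAlgebra.subset_adjoin ℂ _ (by simp), rfl⟩
    have hz : zonal X ξ = zonal X η :=
      h _ ⟨zonal X, StarAlgebra.subset_adjoin ℂ _ (by simp), rfl⟩
    simp only [zonal_apply, eval_X, Complex.ofReal_inj, cosColat] at hz
    refine hne (Subtype.ext ?_)
    ext i
    fin_cases i
    · exact congrArg Complex.re hw
    · exact congrArg Complex.im hw
    · exact hz
  have hdense : Dense (A : Set C(S2, ℂ)) := by
    have h := ContinuousMap.starSubalgebra_topologicalClosure_eq_top_of_separatesPoints A hsep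
    rw [dense_iff_closure_eq, ← StarSubalgebra.topologicalClosure_coe, h]
    rfl
  have himage := (ContinuousMap.toLp_denseRange (p := 2) (μ := surfaceMeasure) (E := ℂ) ℂ
    ENNReal.ofNat_ne_top).dense_image toL2.continuous hdense
  have hsub : (toL2 '' (A : Set C(S2, ℂ))) ⊆ (⨆ ℓ, harmonicSpace ℓ : Submodule ℂ SphereL2) := by
    rintro _ ⟨f, hf, rfl⟩
    obtain ⟨n, hn⟩ := exists_mem_affineFun_pow_of_mem_adjoin hf
    rw [← iSup_harmonicFun] at hn
    have hle : ⨆ ℓ ∈ Set.Iic n, harmonicFun ℓ ≤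
        (⨆ ℓ, harmonicSpace ℓ).comap (toL2 : C(S2, ℂ) →ₗ[ℂ] SphereL2) :=
      iSup₂_le fun ℓ _ g hg => Submodule.mem_iSup_of_mem ℓ (toL2_mem_harmonicSpace hg)
    exact hle hn
  intro X _
  exact (himage.mono hsub) X

theorem orthogonalFamily_harmonicSpace :
    OrthogonalFamily ℂ (fun ℓ => harmonicSpace ℓ) fun ℓ => (harmonicSpace ℓ).subtypeₗᵢ := by
  rintro ℓ ℓ' hne ⟨_, f, hf, rfl⟩ ⟨_, g, hg, rfl⟩
  exact inner_harmonicFun_of_ne hne hf hg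

/-- Parseval's identity for the decomposition into spherical harmonics. -/
theorem hasSum_norm_sq_harmonicProj (X : SphereL2) :
    HasSum (fun ℓ => ‖harmonicProj ℓ X‖ ^ 2) (‖X‖ ^ 2) := by
  have hH := IsHilbertSum.mkInternal harmonicSpace orthogonalFamily_harmonicSpace
    top_le_topologicalClosure_iSup_harmonicSpace
  set W := hH.linearIsometryEquiv X with hW
  have hX : HasSum (fun ℓ => (W ℓ : SphereL2)) X := by
    have h := hH.hasSum_linearIsometryEquiv_symm W
    rwa [hW, LinearIsometryEquiv.symm_apply_apply] at h
  have hproj (ℓ : ℕ) : harmonicProj ℓ X = W ℓ := by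
    have hself : harmonicProj ℓ (W ℓ) = W ℓ := Submodule.starProjection_eq_self_iff.2 (W ℓ).2
    have hne (l : ℕ) (hl : l ≠ ℓ) : harmonicProj ℓ (W l) = 0 :=
      (Submodule.starProjection_apply_eq_zero_iff _).2 fun u hu =>
        orthogonalFamily_harmonicSpace hl.symm ⟨u, hu⟩ (W l)
    rw [← hself]
    exact (hX.mapL (harmonicProj ℓ)).unique (hasSum_single ℓ hne)
  have h := lp.hasSum_norm (p := 2) (by norm_num) W
  simp only [ENNReal.toReal_ofNat, Real.rpow_two, hW, LinearIsometryEquiv.norm_map] at h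
  convert h using 3 with ℓ
  rw [hproj]
  rfl

/-! ### Needlets -/

theorem exists_toL2_eq_harmonicProj (ℓ : ℕ) (X : SphereL2) :
    ∃ f ∈ harmonicFun ℓ, toL2 f = harmonicProj ℓ X :=
  Submodule.mem_map.1 ((harmonicSpace ℓ).starProjection_apply_mem X)

theorem inner_toL2_harmonicProj {ℓ : ℕ} {f : C(S2, ℂ)} (hf : f ∈ harmonicFun ℓ) (X : SphereL2) :
    inner ℂ (toL2 f) (harmonicProj ℓ X) = inner ℂ (toL2 f) X := by
  rw [harmonicProj, ← Submodule.inner_starProjection_left_eq_right,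
    Submodule.starProjection_eq_self_iff.2 (toL2_mem_harmonicSpace hf)]

theorem inner_harmonicProj_self (ℓ : ℕ) (X : SphereL2) :
    inner ℂ X (harmonicProj ℓ X) = ((‖harmonicProj ℓ X‖ ^ 2 : ℝ) : ℂ) := by
  have h : harmonicProj ℓ (harmonicProj ℓ X) = harmonicProj ℓ X :=
    Submodule.starProjection_eq_self_iff.2 ((harmonicSpace ℓ).starProjection_apply_mem X)
  rw [← h, harmonicProj, ← Submodule.inner_starProjection_left_eq_right, ← harmonicProj, h,
    inner_self_eq_norm_sq_to_K]
  push_cast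
  rfl

theorem eq_zero_of_bandLimit_lt {h : ℕ → ℝ} (hfin : (Function.support h).Finite) {ℓ : ℕ}
    (hℓ : bandLimit h < ℓ) : h ℓ = 0 := by
  by_contra hne
  exact absurd (le_csSup hfin.bddAbove hne) (not_le.2 hℓ)

theorem smoothing_eq_sum {h : ℕ → ℝ} (hfin : (Function.support h).Finite) (X : SphereL2) :
    smoothing h X = ∑ ℓ ∈ Finset.range (bandLimit h + 1), (h ℓ : ℂ) • harmonicProj ℓ X := by
  refine tsum_eq_sum fun ℓ hℓ => ?_
  rw [Finset.mem_range, not_lt] at hℓ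
  rw [eq_zero_of_bandLimit_lt hfin hℓ, Complex.ofReal_zero, zero_smul]

/-- The needlet with pole `η`, without its quadrature weight. -/
noncomputable def unweightedNeedlet (h : ℕ → ℝ) (η : S2) : C(S2, ℂ) :=
  ∑ ℓ ∈ Finset.range (bandLimit h + 1), (sqrtWindow h ℓ : ℂ) • legendreKernel ℓ η

theorem needlet_eq (h : ℕ → ℝ) (η : S2) (w : ℝ) :
    needlet h η w = (Real.sqrt w : ℂ) • toL2 (unweightedNeedlet h η) := by
  rw [needlet, ← map_smul]
  congr 1
  ext ξ
  simp [needletFun, unweightedNeedlet, legendreKernel]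

theorem unweightedNeedlet_comm (h : ℕ → ℝ) (ξ η : S2) :
    unweightedNeedlet h η ξ = unweightedNeedlet h ξ η := by
  simp [unweightedNeedlet, legendreKernel, real_inner_comm]

theorem conj_unweightedNeedlet (h : ℕ → ℝ) (η ξ : S2) :
    (starRingEnd ℂ) (unweightedNeedlet h η ξ) = unweightedNeedlet h η ξ := by
  simp [unweightedNeedlet, legendreKernel]

theorem mem_affineFun_pow_of_sum {d : ℕ} (b : ℕ → ℂ) {Y : ℕ → C(S2, ℂ)}
    (hY : ∀ ℓ, Y ℓ ∈ harmonicFun ℓ) :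
    ∑ ℓ ∈ Finset.range (d + 1), b ℓ • Y ℓ ∈ affineFun ^ d :=
  Submodule.sum_mem _ fun ℓ hℓ => Submodule.smul_mem _ _
    (affineFun_pow_mono (by rw [Finset.mem_range] at hℓ; omega)
      (harmonicFun_le_affineFun_pow ℓ (hY ℓ)))

theorem smoothing_eq_sum_needlet {K : Type*} [Fintype K] {h : ℕ → ℝ} (h_nonneg : ∀ ℓ, 0 ≤ h ℓ)
    (hfin : (Function.support h).Finite) {ξ : K → S2} {w : K → ℝ}
    (hq : IsPositiveExactQuadrature ξ w (2 * bandLimit h)) (X : SphereL2) :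
    smoothing h X = ∑ k, needletCoeff h (ξ k) (w k) X • needlet h (ξ k) (w k) := by
  choose Y hY hYX using fun ℓ => exists_toL2_eq_harmonicProj ℓ X
  set d := bandLimit h with hd
  -- The function `F = ∑ b_ℓ Π_ℓ X` is sampled by the needlet coefficients.
  set F : C(S2, ℂ) := ∑ ℓ ∈ Finset.range (d + 1), (sqrtWindow h ℓ : ℂ) • Y ℓ with hF
  have hcoeff (k : K) : needletCoeff h (ξ k) (w k) X = (Real.sqrt (w k) : ℂ) * F (ξ k) := by
    rw [needletCoeff, needlet_eq, inner_smul_left, Complex.conj_ofReal, unweightedNeedlet, map_sum,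
      sum_inner, hF, ContinuousMap.sum_apply]
    congr 1
    refine Finset.sum_congr rfl fun ℓ _ => ?_
    rw [map_smul, inner_smul_left, Complex.conj_ofReal, ContinuousMap.smul_apply, smul_eq_mul,
      ← inner_toL2_harmonicProj (legendreKernel_mem_harmonicFun ℓ (ξ k)), ← hYX,
      inner_legendreKernel _ (hY ℓ)]
  have hsq (k : K) : (Real.sqrt (w k) : ℂ) * Real.sqrt (w k) = w k := by
    rw [← Complex.ofReal_mul, Real.mul_self_sqrt (hq.2 k).le]
  have hrhs : ∑ k, needletCoeff h (ξ k) (w k) X • needlet h (ξ k) (w k) =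
      toL2 (∑ k, ((w k : ℂ) * F (ξ k)) • unweightedNeedlet h (ξ k)) := by
    rw [map_sum]
    refine Finset.sum_congr rfl fun k _ => ?_
    rw [hcoeff, needlet_eq, map_smul, smul_smul, ← hsq k]
    congr 1
    ring
  have hlhs : smoothing h X = toL2 (∑ ℓ ∈ Finset.range (d + 1), (h ℓ : ℂ) • Y ℓ) := by
    rw [smoothing_eq_sum hfin, map_sum]
    exact Finset.sum_congr rfl fun ℓ _ => by rw [map_smul, hYX]
  rw [hrhs, hlhs]
  congr 1
  ext ζ
  -- At the point `ζ` the sum over `k` is the quadrature of a polynomial of degree `2 d`, and the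
  -- integral of that polynomial is computed by the reproducing property.
  have hB : unweightedNeedlet h ζ ∈ affineFun ^ d :=
    mem_affineFun_pow_of_sum _ fun ℓ => legendreKernel_mem_harmonicFun ℓ ζ
  have hprod : unweightedNeedlet h ζ * F ∈ ⨆ ℓ ∈ Set.Iic (2 * d), harmonicFun ℓ := by
    rw [iSup_harmonicFun, two_mul]
    exact mul_mem_affineFun_pow hB (mem_affineFun_pow_of_sum _ hY)
  have hcub := hq.1 _ hprod
  have hint : ∫ η, (unweightedNeedlet h ζ * F) η ∂surfaceMeasure =
      ∑ ℓ ∈ Finset.range (d + 1), (h ℓ : ℂ) * Y ℓ ζ := by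
    have h1 : ∫ η, (unweightedNeedlet h ζ * F) η ∂surfaceMeasure =
        inner ℂ (toL2 (unweightedNeedlet h ζ)) (toL2 F) := by
      rw [inner_toL2]
      simp only [conj_unweightedNeedlet, ContinuousMap.mul_apply]
    rw [h1, unweightedNeedlet, map_sum, sum_inner]
    refine Finset.sum_congr rfl fun ℓ hℓ => ?_
    rw [hF, map_sum, inner_sum, Finset.sum_eq_single_of_mem ℓ hℓ]
    · rw [map_smul, map_smul, inner_smul_left, inner_smul_right, inner_legendreKernel _ (hY ℓ),
        Complex.conj_ofReal, ← mul_assoc, ← Complex.ofReal_mul, sqrtWindow,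
        Real.mul_self_sqrt (h_nonneg ℓ)]
    · intro l _ hl
      rw [map_smul, map_smul, inner_smul_left, inner_smul_right,
        inner_legendreKernel_of_ne hl.symm _ (hY l), mul_zero, mul_zero]
  rw [hint] at hcub
  simp only [ContinuousMap.sum_apply, ContinuousMap.smul_apply, smul_eq_mul]
  rw [hcub]
  refine Finset.sum_congr rfl fun k _ => ?_
  rw [ContinuousMap.mul_apply, unweightedNeedlet_comm h ζ (ξ k)]
  ring

theorem sum_norm_sq_needletCoeff {K : Type*} [Fintype K] {h : ℕ → ℝ} (h_nonneg : ∀ ℓ, 0 ≤ h ℓ)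
    (hfin : (Function.support h).Finite) {ξ : K → S2} {w : K → ℝ}
    (hq : IsPositiveExactQuadrature ξ w (2 * bandLimit h)) (X : SphereL2) :
    ∑ k, ‖needletCoeff h (ξ k) (w k) X‖ ^ 2 =
      ∑ ℓ ∈ Finset.range (bandLimit h + 1), h ℓ * ‖harmonicProj ℓ X‖ ^ 2 := by
  have key := congrArg (inner ℂ X) (smoothing_eq_sum_needlet h_nonneg hfin hq X)
  rw [smoothing_eq_sum hfin, inner_sum, inner_sum] at key
  have h1 (k : K) : inner ℂ X (needletCoeff h (ξ k) (w k) X • needlet h (ξ k) (w k)) =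
      ((‖needletCoeff h (ξ k) (w k) X‖ ^ 2 : ℝ) : ℂ) := by
    rw [inner_smul_right, ← inner_conj_symm X, ← needletCoeff, Complex.mul_conj,
      Complex.normSq_eq_norm_sq]
  simp only [h1, inner_smul_right, inner_harmonicProj_self] at key
  exact_mod_cast key.symm

/-- A family which satisfies Parseval's identity reconstructs every vector: the analysis operator
into `ℓ²` is an isometry `T`, so that `T† T = 1`, and `T†` maps `e_i` to `ψ_i`. -/
theorem hasSum_inner_smul_of_parseval {ι E : Type*} [NormedAddCommGroup E] [InnerProductSpace ℂ E]
    [CompleteSpace E] {ψ : ι → E} (hψ : ∀ x, HasSum (fun i => ‖inner ℂ (ψ i) x‖ ^ 2) (‖x‖ ^ 2))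
    (x : E) : HasSum (fun i => inner ℂ (ψ i) x • ψ i) x := by
  classical
  have hmem (x : E) : Memℓp (fun i => inner ℂ (ψ i) x) 2 :=
    memℓp_gen (by simpa using (hψ x).summable)
  let T : E →ₗᵢ[ℂ] lp (fun _ : ι => ℂ) 2 :=
    { toFun := fun x => ⟨fun i => inner ℂ (ψ i) x, hmem x⟩
      map_add' := fun x y => by ext i; exact inner_add_right _ _ _
      map_smul' := fun c x => by ext i; exact inner_smul_right _ _ _
      norm_map' := fun x => by
        have h := lp.hasSum_norm (p := 2) (by norm_num)
          (⟨fun i => inner ℂ (ψ i) x, hmem x⟩ : lp (fun _ : ι => ℂ) 2)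
        simp only [ENNReal.toReal_ofNat, Real.rpow_two] at h
        exact (sq_eq_sq₀ (norm_nonneg _) (norm_nonneg _)).1 (h.unique (hψ x)) }
  have hT : ContinuousLinearMap.adjoint T.toContinuousLinearMap (T x) = x := by
    refine ext_inner_left ℂ fun y => ?_
    rw [ContinuousLinearMap.adjoint_inner_right]
    exact T.inner_map_map y x
  have hsingle (i : ι) (c : ℂ) :
      ContinuousLinearMap.adjoint T.toContinuousLinearMap (lp.single 2 i c) = c • ψ i := by
    refine ext_inner_left ℂ fun y => ?_
    rw [ContinuousLinearMap.adjoint_inner_right, lp.inner_single_right, inner_smul_right,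
      ← inner_conj_symm y, mul_comm]
    exact mul_comm _ _
  have h := (lp.hasSum_single (E := fun _ : ι => ℂ) (p := 2) ENNReal.ofNat_ne_top (T x)).mapL
    (ContinuousLinearMap.adjoint T.toContinuousLinearMap)
  rw [hT] at h
  simp only [hsingle] at h
  exact h

theorem hasSum_norm_sq_needletCoeff {J : Type*} {K : J → Type*} [∀ j, Fintype (K j)]
    {h : J → ℕ → ℝ} (h_nonneg : ∀ j ℓ, 0 ≤ h j ℓ)
    (h_fin : ∀ j, (Function.support (h j)).Finite)
    {ξ : ∀ j, K j → S2} {w : ∀ j, K j → ℝ}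
    (hq : ∀ j, IsPositiveExactQuadrature (ξ j) (w j) (2 * bandLimit (h j)))
    (hsum : ∀ ℓ, HasSum (fun j => h j ℓ) 1) (X : SphereL2) :
    HasSum (fun p : Σ j, K j => ‖needletCoeff (h p.1) (ξ p.1 p.2) (w p.1 p.2) X‖ ^ 2)
      (‖X‖ ^ 2) := by
  set a := fun ℓ => ‖harmonicProj ℓ X‖ ^ 2 with ha
  -- Sum `h j ℓ * ‖Π_ℓ X‖²` in both orders.
  have hrow (ℓ : ℕ) : HasSum (fun j => h j ℓ * a ℓ) (a ℓ) := by
    simpa using (hsum ℓ).mul_right (a ℓ)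
  have hparseval : HasSum a (‖X‖ ^ 2) := hasSum_norm_sq_harmonicProj X
  have hdouble : HasSum (fun p : ℕ × J => h p.2 p.1 * a p.1) (‖X‖ ^ 2) := by
    have hs : Summable fun p : ℕ × J => h p.2 p.1 * a p.1 := by
      refine (summable_prod_of_nonneg fun p => ?_).2 ⟨fun ℓ => (hrow ℓ).summable, ?_⟩
      · exact mul_nonneg (h_nonneg _ _) (sq_nonneg _)
      · simpa only [(hrow _).tsum_eq] using hparseval.summable
    have h := hs.hasSum.prod_fiberwise hrow
    rw [hparseval.unique h]
    exact hs.hasSum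
  have hcol (j : J) : HasSum (fun k => ‖needletCoeff (h j) (ξ j k) (w j k) X‖ ^ 2)
      (∑ ℓ ∈ Finset.range (bandLimit (h j) + 1), h j ℓ * a ℓ) := by
    rw [ha, ← sum_norm_sq_needletCoeff (h_nonneg j) (h_fin j) (hq j) X]
    exact hasSum_fintype _
  have hswap : HasSum (fun p : J × ℕ => h p.1 p.2 * a p.2) (‖X‖ ^ 2) :=
    (Equiv.prodComm J ℕ).hasSum_iff.2 hdouble
  have houter : HasSum (fun j => ∑ ℓ ∈ Finset.range (bandLimit (h j) + 1), h j ℓ * a ℓ)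
      (‖X‖ ^ 2) := by
    refine hswap.prod_fiberwise fun j => hasSum_sum_of_ne_finset_zero fun ℓ hℓ => ?_
    rw [Finset.mem_range, not_lt] at hℓ
    rw [eq_zero_of_bandLimit_lt (h_fin j) hℓ, zero_mul]
  refine houter.sigma_of_hasSum hcol ?_
  refine (summable_sigma_of_nonneg fun p => sq_nonneg _).2 ⟨fun j => (hcol j).summable, ?_⟩
  simpa only [(hcol _).tsum_eq] using houter.summable

end SphereNeedlet

theorem proposition1 {J : Type*} [Countable J] {K : J → Type*} [∀ j, Fintype (K j)]
    (h : J → ℕ → ℝ) (h_nonneg : ∀ j ℓ, 0 ≤ h j ℓ)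
    (h_fin : ∀ j, (Function.support (h j)).Finite)
    (ξ : ∀ j, K j → SphereNeedlet.S2) (w : ∀ j, K j → ℝ) :
    (∀ j, SphereNeedlet.IsPositiveExactQuadrature (ξ j) (w j)
        (2 * SphereNeedlet.bandLimit (h j)) →
      ∀ X : SphereNeedlet.SphereL2,
        SphereNeedlet.smoothing (h j) X =
          ∑ k, SphereNeedlet.needletCoeff (h j) (ξ j k) (w j k) X •
            SphereNeedlet.needlet (h j) (ξ j k) (w j k)) ∧
    ((∀ j, SphereNeedlet.IsPositiveExactQuadrature (ξ j) (w j)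
        (2 * SphereNeedlet.bandLimit (h j))) →
      (∀ ℓ, HasSum (fun j => h j ℓ) 1) →
      SphereNeedlet.IsTightFrame (fun p : Σ j, K j =>
        SphereNeedlet.needlet (h p.1) (ξ p.1 p.2) (w p.1 p.2)) ∧
      ∀ X : SphereNeedlet.SphereL2,
        HasSum (fun p : Σ j, K j =>
          SphereNeedlet.needletCoeff (h p.1) (ξ p.1 p.2) (w p.1 p.2) X •
            SphereNeedlet.needlet (h p.1) (ξ p.1 p.2) (w p.1 p.2)) X ∧
        HasSum (fun p : Σ j, K j =>
          ‖SphereNeedlet.needletCoeff (h p.1) (ξ p.1 p.2) (w p.1 p.2) X‖ ^ 2) (‖X‖ ^ 2)) := by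
  refine ⟨fun j hq X =>
    SphereNeedlet.smoothing_eq_sum_needlet (h_nonneg j) (h_fin j) hq X, fun hq hsum => ?_⟩
  have hP := SphereNeedlet.hasSum_norm_sq_needletCoeff h_nonneg h_fin hq hsum
  refine ⟨⟨1, one_pos, fun X => ⟨(hP X).summable, ?_, ?_⟩⟩, fun X =>
    ⟨SphereNeedlet.hasSum_inner_smul_of_parseval hP X, hP X⟩⟩
  · rw [one_mul]
    exact (hP X).tsum_eq.ge
  · rw [one_mul]
    exact (hP X).tsum_eq.le
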